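/- **Setting.** Let $G=(V,E)$ be a finite connected undirected graph, $m\ge 0$, $\mathbf X=(\mathbb R^m)^V$ with the Euclidean norm, $\bar{\mathbf x}\in\mathbf X$, $\bar E=E\times\{1,\dots,m\}$, and for $((i,j),k)\in\bar E$ let $H_{((i,j),k)}=\{\mathbf x\in\mathbf X:[[\mathbf x]_i]_k=[[\mathbf x]_j]_k\}$. Let $f_i:\mathbb R^m\to\mathbb R\cup\{\infty\}$ ($i\in V$) be closed convex functions and $V=V_1\cup V_2\cup V_3\cup V_4$ a partition such that $f_i$ is the indicator function of a closed convex set for $i\in V_2$, $\mathrm{dom} f_i=\mathbb R^m$ for $i\in V_3$, and, for $i\in V_4$, $f_i$ is real-valued and differentiable with $\nabla f_i$ Lipschitz with constant $1/\sigma$, $\sigma>0$ (the nodes in $V_1\cup V_2\cup V_3$ are handled by exact minimization, those in $V_4$ by linearization). Assume $\bigcap_i \mathrm{dom} f_i\ne\emptyset$. For $g_i:\mathbb R^m\to\mathbb R\cup\{\infty\}$ put $\mathbf g_i(\mathbf x)=g_i([\mathbf x]_i)$, put $\mathbf g_\alpha=\delta_{H_\alpha}$ for $\alpha\in\bar E$,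 let ${}^*$ be the Fenchel conjugate, and for $\mathbf z\in\mathbf X^{V\cup\bar E}$ let $$F_{S}[g](\mathbf z)=\sum_{i\in V}\mathbf g_i^*(\mathbf z_i)+\sum_{\alpha\in\bar E}\delta_{H_\alpha}^*(\mathbf z_\alpha)+\tfrac12\Big\|\bar{\mathbf x}-\sum_{\alpha\in V\cup\bar E}\mathbf z_\alpha\Big\|^2 .$$ Write $F_S=F_S[f]$ and $\mathbf v_H=\sum_{\alpha\in\bar E}\mathbf z_\alpha$. **Algorithm.** Fix $\bar w\ge1$, $C_{reg}>0$. Start: $\mathbf z_i^{1,0}$ with $[\mathbf z_i^{1,0}]_j=0$ for $j\ne i$; $\mathbf v_H^{1,0}\in(\bigcap_{\alpha\in\bar E}H_\alpha)^\perp$; for $i\in V_4$ a real-valued convex function $f_{i,1,0}\le f_i$. For $i\notin V_4$ let $f_{i,n,w}=f_i$ throughout. For $n=1,2,\dots$: * choose $\bar E_n\subset\bar E$ with $\bigcap_{\alpha\in\bar E_n}H_\alpha=\bigcap_{\alpha\in\bar E}H_\alpha$, and choose $\mathbf z_\alpha^{n,0}\in H_\alpha^\perp$ ($\alpha\in\bar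 E$) with $\mathbf z^{n,0}_\alpha=0$ for $\alpha\notin\bar E_n$, $\|\mathbf z_\alpha^{n,0}\|\le C_{reg}\|\mathbf v_H^{n,0}\|$ and $\sum_{\alpha\in\bar E}\mathbf z_\alpha^{n,0}=\mathbf v_H^{n,0}$; * for $w=1,\dots,\bar w$ choose $\emptyset\ne S_{n,w}\subset\bar E_n\cup V$ and keep $\mathbf z_\alpha^{n,w}=\mathbf z_\alpha^{n,w-1}$ for $\alpha\notin S_{n,w}$. - If $S_{n,w}\not\subset V_4$, keep $f_{i,n,w}=f_{i,n,w-1}$ for $i\in V_4$ and let $\{\mathbf z^{n,w}_\alpha\}_{\alpha\in S_{n,w}}$ minimize $F_S[(f_{i,n,w})_i]$ in these variables, the others being fixed (in the minimization the constant terms $\mathbf f^*_{\alpha,n,w}(\mathbf z_\alpha)$, $\alpha\notin S_{n,w}$, are left out). - If $S_{n,w}\subset V_4$, do for each $i\in S_{n,w}$: let $p=[\bar{\mathbf x}-\mathbf v_H^{n,w-1}]_i$, $q=[\bar{\mathbf x}-\mathbf v_H^{n,w-1}-\mathbf z_i^{n,w-1}]_i$, $s\in\partial f_i(q)$, $M(x)=\max\{f_{i,n,w-1}(x),\,f_i(q)+\langle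 s,x-q\rangle\}$; let $x^+$ minimize $\frac12\|p-x\|^2+M(x)$ and let $z^+$ minimize $\frac12\|p-z\|^2+M^*(z)$; set $f_{i,n,w}(x)=M(x^+)+\langle x-x^+,p-x^+\rangle$, $[\mathbf z_i^{n,w}]_i=z^+$, $[\mathbf z_i^{n,w}]_j=0$ for $j\neq i$. Keep $f_{i,n,w}=f_{i,n,w-1}$ for $i\in V_4\setminus S_{n,w}$; * put $\mathbf z_i^{n+1,0}=\mathbf z_i^{n,\bar w}$ ($i\in V$), $\mathbf v_H^{n+1,0}=\sum_{\alpha\in\bar E}\mathbf z_\alpha^{n,\bar w}$, $f_{i,n+1,0}=f_{i,n,\bar w}$ ($i\in V_4$). **Theorem.** Consider a sequence generated by this algorithm such that for all $n\ge1$: $\bar E_n=\bar E\cap\bigcup_{w=1}^{\bar w}S_{n,w}$ and $V\subset\bigcup_{w=1}^{\bar w}S_{n,w}$; and, if $V_4\neq\emptyset$, $S_{n,1}=V_4$ for all $n>1$. Let $\mathbf z^*$ be a minimizer of $F_S$. Assume that the iterates $\{\mathbf z_i^{n,w}\}_{n\ge1,\,0\le w\le\bar w}$, $i\in V$, are bounded,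 or that the following constraint qualification holds at the minimizer $x^*$ of $\sum_{i\in V}[\frac12\|x-[\bar{\mathbf x}]_i\|^2+f_i(x)]$: if $y_i\in N_{\mathrm{cl}(\mathrm{dom} f_i)}(x^*)$ for all $i\in V_1\cup V_2$ and $\sum_{i\in V_1\cup V_2}y_i=0$, then $y_i=0$ for all $i\in V_1\cup V_2$. Let $$h^n=F_S[(f_{i,n,0})_i](\mathbf z^{n,0})-F_S(\mathbf z^*)\in\mathbb R\cup\{\infty\}.$$ Then $h^n\ge0$ for all $n\ge1$, $h^n<\infty$ for all $n\ge2$, and there is a constant $C$ with $h^n\le C/n$ for all $n\ge1$ with $h^n<\infty$; that is, $h^n\to0$ at the rate $O(1/n)$. (The value $h^1=\infty$ can occur only if the starting point has infinite dual value.) -/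

import Mathlib

/-- The block space `ℝᵐ` attached to one node, with the Euclidean norm. -/
abbrev Block (m : ℕ) : Type := EuclideanSpace ℝ (Fin m)

/-- The product space `𝐗 = (ℝᵐ)^V`, with the Euclidean (product Hilbert) norm. -/
abbrev NodeProd (V : Type*) [Fintype V] (m : ℕ) : Type _ := PiLp 2 (fun _ : V => Block m)

/-- The index set `Ē = E × {1, …, m}`, where `E` is the edge set of the graph. -/
abbrev EdgeIdx {V : Type*} (G : SimpleGraph V) (m : ℕ) : Type _ := G.edgeSet × Fin m

/-- The index set `V ∪ Ē` (a disjoint union) of the dual variables. -/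
abbrev DualIdx {V : Type*} (G : SimpleGraph V) (m : ℕ) : Type _ := V ⊕ EdgeIdx G m

/-- The four classes `V₁, V₂, V₃, V₄` of nodes. -/
inductive NodeKind : Type
  /-- `V₁`: a closed convex proximable function. -/
  | proximable
  /-- `V₂`: the indicator function of a closed convex set. -/
  | indicator
  /-- `V₃`: a closed convex proximable function with full domain. -/
  | fullDomainProximable
  /-- `V₄`: a function with full domain, handled through subgradients. -/
  | subdifferentiable

section Convex

variable {H : Type*} [NormedAddCommGroup H] [InnerProductSpace ℝ H]

/-- The indicator function `δ_C`: zero on `C`, `+∞` off `C`. -/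
noncomputable def indicatorFn (C : Set H) (x : H) : EReal :=
  open Classical in if x ∈ C then 0 else ⊤

/-- The Fenchel conjugate `f^*(z) = sup_x (⟨z, x⟩ - f x)`. -/
noncomputable def conjugate (f : H → EReal) (z : H) : EReal :=
  ⨆ x : H, ((inner ℝ z x : ℝ) : EReal) - f x

/-- The effective domain `{x | f x < +∞}`. -/
def effDom (f : H → EReal) : Set H := {x | f x < ⊤}

/-- A closed convex function with values in `ℝ ∪ {+∞}`: no value is `-∞`, it is lower
semicontinuous, and its epigraph is convex. -/
def IsClosedConvexFn (f : H → EReal) : Prop :=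
  (∀ x, f x ≠ ⊥) ∧ LowerSemicontinuous f ∧ Convex ℝ {p : H × ℝ | f p.1 ≤ (p.2 : EReal)}

/-- `s ∈ ∂f(x)`, the convex subdifferential. -/
def IsSubgradientAt (f : H → EReal) (x s : H) : Prop :=
  f x ≠ ⊤ ∧ ∀ y, f x + ((inner ℝ s (y - x) : ℝ) : EReal) ≤ f y

/-- The normal cone `N_C(x)` of a convex set `C` at a point `x` of `C`. -/
def normalConeAt (C : Set H) (x : H) : Set H := {y | ∀ c ∈ C, inner ℝ y (c - x) ≤ 0}

end Convex

section Consensus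

variable {V : Type*} [Fintype V]

/-- The subspace `H_{((i,j),k)} = {𝐱 | [[𝐱]_i]_k = [[𝐱]_j]_k}`. -/
def edgeSubspace (G : SimpleGraph V) (m : ℕ) (α : EdgeIdx G m) :
    Submodule ℝ (NodeProd V m) where
  carrier := {x | ∀ i j : V, (α.1 : Sym2 V) = s(i, j) → x i α.2 = x j α.2}
  add_mem' := by
    intro x y hx hy i j h
    have h1 := hx i j h
    have h2 := hy i j h
    simp [h1, h2]
  zero_mem' := by
    intro i j _
    simp
  smul_mem' := by
    intro c x hx i j h
    have h1 := hx i j h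
    simp [h1]

/-- A set `E'` of indices connects `V`: `⋂_{α ∈ E'} H_α = ⋂_{α ∈ Ē} H_α`. -/
def ConnectsNodes (G : SimpleGraph V) (m : ℕ) (E' : Set (EdgeIdx G m)) : Prop :=
  (⨅ α ∈ E', edgeSubspace G m α) = ⨅ α, edgeSubspace G m α

/-- The functions `𝐟_α : 𝐗 → ℝ ∪ {+∞}`, `α ∈ V ∪ Ē`, built from node functions `g_i : ℝᵐ → ℝ ∪ {+∞}`:
`𝐟_i(𝐱) = g_i([𝐱]_i)` for `i ∈ V` and `𝐟_α = δ_{H_α}` for `α ∈ Ē`. -/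
noncomputable def boldFn (G : SimpleGraph V) (m : ℕ) (g : V → Block m → EReal) :
    DualIdx G m → NodeProd V m → EReal
  | Sum.inl i => fun x => g i (x i)
  | Sum.inr α => indicatorFn (edgeSubspace G m α : Set (NodeProd V m))

/-- The negated dual function
`∑_{i ∈ V} 𝐠_i^*(𝐳_i) + ∑_{α ∈ Ē} δ_{H_α}^*(𝐳_α) + ½‖𝐱̄ - ∑_α 𝐳_α‖²`.
For `g = f` it is `F_S`, for `g = (f_{i,n,w})_i` it is `F̃_S^{n,w}`. -/
noncomputable def dualFn (G : SimpleGraph V) (m : ℕ) [Fintype G.edgeSet]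
    (xbar : NodeProd V m) (g : V → Block m → EReal) (z : DualIdx G m → NodeProd V m) : EReal :=
  (∑ α, conjugate (boldFn G m g α) (z α)) + ((1 / 2 * ‖xbar - ∑ α, z α‖ ^ 2 : ℝ) : EReal)

/-- `𝐯_H = ∑_{α ∈ Ē} 𝐳_α`. -/
noncomputable def vH (G : SimpleGraph V) (m : ℕ) [Fintype G.edgeSet]
    (z : DualIdx G m → NodeProd V m) : NodeProd V m :=
  ∑ α : EdgeIdx G m, z (Sum.inr α)

/-- The primal objective `x ↦ ∑_{i ∈ V} [½‖x - [𝐱̄]_i‖² + f_i(x)]` of the consensus problem. -/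
noncomputable def primalFn {m : ℕ} (xbar : NodeProd V m) (f : V → Block m → EReal) (x : Block m) :
    EReal :=
  ∑ i, (((1 / 2 * ‖x - xbar i‖ ^ 2 : ℝ) : EReal) + f i x)

/-- The standing assumptions on the node functions: all are closed convex, those in `V₂` are
indicators of closed convex sets, those in `V₃` have full domain, those in `V₄` are
real-valued and differentiable with `1/σ`-Lipschitz gradient. -/
def NodeAssumptions {m : ℕ} (kind : V → NodeKind) (f : V → Block m → EReal) (σ : ℝ) : Prop :=
  ∀ i, IsClosedConvexFn (f i) ∧
    (kind i = .indicator →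
      ∃ C : Set (Block m), IsClosed C ∧ Convex ℝ C ∧ f i = indicatorFn C) ∧
    (kind i = .fullDomainProximable → effDom (f i) = Set.univ) ∧
    (kind i = .subdifferentiable →
      ∃ g : Block m → ℝ, (∀ x, f i x = (g x : EReal)) ∧ Differentiable ℝ g ∧
        ∀ x y, ‖gradient g x - gradient g y‖ ≤ (1 / σ) * ‖x - y‖)

/-- The constraint qualification at `x`: if `y_i ∈ N_{cl dom f_i}(x)` for `i ∈ V₁ ∪ V₂` and
`∑_{i ∈ V₁ ∪ V₂} y_i = 0`, then all these `y_i` are zero. -/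
def ConstraintQualification {m : ℕ} (kind : V → NodeKind) (f : V → Block m → EReal)
    (x : Block m) : Prop :=
  open Classical in
  ∀ y : V → Block m,
    (∀ i, kind i = .proximable ∨ kind i = .indicator →
      y i ∈ normalConeAt (closure (effDom (f i))) x) →
    (∑ i with kind i = .proximable ∨ kind i = .indicator, y i) = 0 →
    ∀ i, kind i = .proximable ∨ kind i = .indicator → y i = 0

/-- One run of the subgradient subalgorithm at a node with function `f`, current minorant `g`,
linearization point `q` and proximal center `p`: it produces the new affine minorant `g'` and
the new dual block `z'`.
A linearization `f̃` of `f` at `q` is formed, `x⁺` solves `min ½‖p - x‖² + max{g, f̃}(x)`, the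
dual solution `z'` minimizes `½‖p - z‖² + (max{g, f̃})^*(z)`, and `g'` is the affine function
of slope `p - x⁺` that agrees with `max{g, f̃}` at `x⁺`. -/
def SubgradientStep {m : ℕ} (f g : Block m → EReal) (q p : Block m)
    (g' : Block m → EReal) (z' : Block m) : Prop :=
  ∃ s : Block m, IsSubgradientAt f q s ∧
    ∃ M : Block m → EReal,
      (∀ x, M x = max (g x) (f q + ((inner ℝ s (x - q) : ℝ) : EReal))) ∧
    ∃ xp : Block m,
      (∀ x, ((1 / 2 * ‖p - xp‖ ^ 2 : ℝ) : EReal) + M xp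
        ≤ ((1 / 2 * ‖p - x‖ ^ 2 : ℝ) : EReal) + M x) ∧
      (∀ z, ((1 / 2 * ‖p - z'‖ ^ 2 : ℝ) : EReal) + conjugate M z'
        ≤ ((1 / 2 * ‖p - z‖ ^ 2 : ℝ) : EReal) + conjugate M z) ∧
      (∀ x, g' x = M xp + ((inner ℝ (x - xp) (p - xp) : ℝ) : EReal))

/-- The objective of the block minimization over the indices in `S`:
`½‖𝐱̄ - ∑_α 𝐳_α‖² + ∑_{α ∈ S} 𝐠_α^*(𝐳_α)`. -/
noncomputable def blockObjective (G : SimpleGraph V) (m : ℕ) [Fintype G.edgeSet]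
    (xbar : NodeProd V m) (g : V → Block m → EReal) (S : Finset (DualIdx G m))
    (z : DualIdx G m → NodeProd V m) : EReal :=
  ((1 / 2 * ‖xbar - ∑ α, z α‖ ^ 2 : ℝ) : EReal) + ∑ α ∈ S, conjugate (boldFn G m g α) (z α)

/-- The index set `V₄`, as a set of dual indices. -/
def subdiffIdx (G : SimpleGraph V) (m : ℕ) (kind : V → NodeKind) : Set (DualIdx G m) :=
  Sum.inl '' {i | kind i = .subdifferentiable}

/-- `IsDykstraRun` says that the dual vectors `z n w = (𝐳_α^{n,w})_α` and the node functions
`fm n w i = f_{i,n,w}` (`n ≥ 1`, `0 ≤ w ≤ wbar`; values at other indices are irrelevant) are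
generated by the distributed Dykstra algorithm with index sets `En n = Ē_n`, `S n w = S_{n,w}`
and constant `Creg`. -/
structure IsDykstraRun (G : SimpleGraph V) (m : ℕ) [Fintype G.edgeSet]
    (kind : V → NodeKind) (f : V → Block m → EReal) (xbar : NodeProd V m)
    (wbar : ℕ) (Creg : ℝ) (En : ℕ → Set (EdgeIdx G m)) (S : ℕ → ℕ → Finset (DualIdx G m))
    (fm : ℕ → ℕ → V → Block m → EReal) (z : ℕ → ℕ → DualIdx G m → NodeProd V m) : Prop where
  /-- There is at least one inner iteration. -/
  wbar_pos : 1 ≤ wbar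
  Creg_pos : 0 < Creg
  /-- The starting vector of node `i` lives in block `i`. -/
  start_sparse : ∀ i j, j ≠ i → z 1 0 (Sum.inl i) j = 0
  /-- The starting minorant of a node in `V₄` is a real-valued convex function below `f_i`. -/
  start_minorant : ∀ i, kind i = .subdifferentiable →
    (∃ g : Block m → ℝ, ConvexOn ℝ Set.univ g ∧ ∀ x, fm 1 0 i x = (g x : EReal)) ∧
    ∀ x, fm 1 0 i x ≤ f i x
  /-- Outside `V₄` the function is never replaced. -/
  fm_eq : ∀ n ≥ 1, ∀ w ≤ wbar, ∀ i, kind i ≠ .subdifferentiable → fm n w i = f i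
  /-- `Ē_n` connects `V`. -/
  connects : ∀ n ≥ 1, ConnectsNodes G m (En n)
  /-- The reset of the edge variables at the start of cycle `n`; their sum `𝐯_H^{n,0}` is an
  arbitrary element of `D^⊥` for `n = 1` and is carried over from the previous cycle, see
  `next_vH`, for `n ≥ 2`. -/
  reset_zero : ∀ n ≥ 1, ∀ α, α ∉ En n → z n 0 (Sum.inr α) = 0
  reset_perp : ∀ n ≥ 1, ∀ α, z n 0 (Sum.inr α) ∈ (edgeSubspace G m α)ᗮ
  reset_bound : ∀ n ≥ 1, ∀ α, ‖z n 0 (Sum.inr α)‖ ≤ Creg * ‖vH G m (z n 0)‖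
  /-- `∅ ≠ S_{n,w} ⊆ Ē_n ∪ V`. -/
  S_nonempty : ∀ n ≥ 1, ∀ w, 1 ≤ w → w ≤ wbar → (S n w).Nonempty
  S_edges : ∀ n ≥ 1, ∀ w, 1 ≤ w → w ≤ wbar → ∀ α, Sum.inr α ∈ S n w → α ∈ En n
  /-- If `S_{n,w} ⊆ V₄`, the subgradient subalgorithm is run at each node of `S_{n,w}`. -/
  subgradient_step : ∀ n ≥ 1, ∀ w, w + 1 ≤ wbar →
    (S n (w + 1) : Set (DualIdx G m)) ⊆ subdiffIdx G m kind →
    (∀ i, Sum.inl i ∈ S n (w + 1) →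
      SubgradientStep (f i) (fm n w i)
        ((xbar - vH G m (z n w) - z n w (Sum.inl i)) i) ((xbar - vH G m (z n w)) i)
        (fm n (w + 1) i) (z n (w + 1) (Sum.inl i) i) ∧
      ∀ j, j ≠ i → z n (w + 1) (Sum.inl i) j = 0) ∧
    ∀ i, kind i = .subdifferentiable → Sum.inl i ∉ S n (w + 1) → fm n (w + 1) i = fm n w i
  /-- Otherwise the functions are kept and the dual objective is optimized over the block
  `S_{n,w}`. -/
  block_step : ∀ n ≥ 1, ∀ w, w + 1 ≤ wbar →
    ¬ (S n (w + 1) : Set (DualIdx G m)) ⊆ subdiffIdx G m kind →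
    (∀ i, kind i = .subdifferentiable → fm n (w + 1) i = fm n w i) ∧
    ∀ y : DualIdx G m → NodeProd V m, (∀ α, α ∉ S n (w + 1) → y α = z n w α) →
      blockObjective G m xbar (fm n (w + 1)) (S n (w + 1)) (z n (w + 1))
        ≤ blockObjective G m xbar (fm n (w + 1)) (S n (w + 1)) y
  /-- Dual variables outside `S_{n,w}` are kept. -/
  keep : ∀ n ≥ 1, ∀ w, w + 1 ≤ wbar → ∀ α, α ∉ S n (w + 1) → z n (w + 1) α = z n w α
  /-- Passage to the next cycle. -/
  next_z : ∀ n ≥ 1, ∀ i, z (n + 1) 0 (Sum.inl i) = z n wbar (Sum.inl i)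
  next_vH : ∀ n ≥ 1, vH G m (z (n + 1) 0) = vH G m (z n wbar)
  next_fm : ∀ n ≥ 1, ∀ i, kind i = .subdifferentiable → fm (n + 1) 0 i = fm n wbar i

/-- The dual gap `h^n = F̃_S^{n,0}(𝐳^{n,0}) - F_S(𝐳^*)`. -/
noncomputable def dualGap (G : SimpleGraph V) (m : ℕ) [Fintype G.edgeSet]
    (xbar : NodeProd V m) (f : V → Block m → EReal) (fm : ℕ → ℕ → V → Block m → EReal)
    (z : ℕ → ℕ → DualIdx G m → NodeProd V m) (zstar : DualIdx G m → NodeProd V m) (n : ℕ) : EReal :=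
  dualFn G m xbar (fm n 0) (z n 0) - dualFn G m xbar f zstar

end Consensus

/-! ### Finite sums of extended reals -/

section ExtendedReal

/-! Let `x n w` be the residual `xbar - ∑ α, z n w α`, the primal iterate attached to the dual
point. Both kinds of update make the new residual act as a subgradient when the updated dual term is
compared with its old value: for an exact block minimization this is optimality
(`conjugate_subgradient_of_block_min`), for a linearized step it is prox duality for the bundle
model (`SubgradientStep.spec`). Summing these inequalities and completing the square
(`value_descent`), each step lowers the dual value by at least half the squared movement of the
residual. The same computation at the minimizer `zstar` bounds the distance of all residuals from
the optimal one.

Conversely, the gap after a cycle is controlled by the movement in that cycle. Each node block is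
anchored at a residual of the cycle that is a subgradient of the true conjugate, up to a multiple of
the squared movement (`IsDykstraRun.node_anchor`); each used edge subspace contains a residual of
the cycle (`IsDykstraRun.edge_anchor`). All these residuals lie within the total movement `s` of the
last one. Convexity, together with linear regularity of the edge subspaces
(`exists_uniform_inner_le_of_near_subspaces`), then gives a gap of at most `A * s + B * q`, with `q`
the sum of squared movements (`gap_le_of_anchors`). This needs bounded node blocks, which are
assumed or follow from the constraint qualification by a recession argument
(`ConstraintQualification.exists_norm_le`). Edge blocks enter only through their sum.

Since `s ^ 2 ≤ wbar * q` and `q` is at most twice the decrease of the gap over the cycle, the gaps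
satisfy `h (n + 1) ^ 2 ≤ κ * (h n - h (n + 1))` (`sq_gap_le`), and such a sequence is O(1/n)
(`exists_le_div_of_sq_le`). -/

lemma EReal.exists_coe_of_ne {a : EReal} (hb : a ≠ ⊥) (ht : a ≠ ⊤) : ∃ r : ℝ, a = (r : EReal) :=
  ⟨a.toReal, (EReal.coe_toReal ht hb).symm⟩

lemma EReal.sum_coe {ι : Type*} (s : Finset ι) (r : ι → ℝ) :
    ∑ i ∈ s, (r i : EReal) = ((∑ i ∈ s, r i : ℝ) : EReal) := by
  classical
  induction s using Finset.induction_on with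
  | empty => simp
  | insert a s ha ih => rw [Finset.sum_insert ha, Finset.sum_insert ha, ih, EReal.coe_add]

lemma EReal.sum_ne_bot_of_forall {ι : Type*} (s : Finset ι) (f : ι → EReal)
    (h : ∀ i ∈ s, f i ≠ ⊥) : ∑ i ∈ s, f i ≠ ⊥ := by
  classical
  induction s using Finset.induction_on with
  | empty => simp
  | insert a s ha ih =>
    rw [Finset.sum_insert ha, EReal.add_ne_bot_iff]
    exact ⟨h a (by simp), ih fun i hi => h i (by simp [hi])⟩

lemma EReal.ne_top_of_sum_ne_top {ι : Type*} (s : Finset ι) (f : ι → EReal)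
    (h : ∀ i ∈ s, f i ≠ ⊥) (hs : ∑ i ∈ s, f i ≠ ⊤) : ∀ i ∈ s, f i ≠ ⊤ := by
  classical
  induction s using Finset.induction_on with
  | empty => simp
  | insert a s ha ih =>
    have hb := EReal.sum_ne_bot_of_forall s f fun i hi => h i (by simp [hi])
    rw [Finset.sum_insert ha, EReal.add_ne_top_iff_ne_top₂ (h a (by simp)) hb] at hs
    intro i hi
    rcases Finset.mem_insert.1 hi with rfl | hi
    · exact hs.1
    · exact ih (fun i hi => h i (by simp [hi])) hs.2 i hi

lemma EReal.sum_ne_top_of_forall {ι : Type*} (s : Finset ι) (f : ι → EReal)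
    (h : ∀ i ∈ s, f i ≠ ⊤) : ∑ i ∈ s, f i ≠ ⊤ := by
  classical
  induction s using Finset.induction_on with
  | empty => simp
  | insert a s ha ih =>
    rw [Finset.sum_insert ha]
    exact EReal.add_ne_top (h a (by simp)) (ih fun i hi => h i (by simp [hi]))

end ExtendedReal

/-! ### Fenchel conjugates and subgradients from minimization -/

section Conjugate

variable {H : Type*} [NormedAddCommGroup H] [InnerProductSpace ℝ H]

/-- Testing against points `(x, t)` of the epigraph replaces extended subtraction by real
inequalities. A value `⊤` of `f` imposes nothing, and a value `⊥` makes both sides false because `t`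
is then arbitrary. -/
lemma conjugate_le_coe_iff {f : H → EReal} {z : H} {r : ℝ} :
    conjugate f z ≤ (r : EReal) ↔ ∀ (x : H) (t : ℝ), f x ≤ (t : EReal) → inner ℝ z x - t ≤ r := by
  unfold conjugate
  rw [iSup_le_iff]
  refine forall_congr' fun x => ?_
  induction h : f x with
  | bot =>
    simp only [EReal.coe_sub_bot, bot_le, forall_const]
    constructor
    · intro h; simp at h
    · intro h
      have := h (inner ℝ z x - r - 1)
      linarith
  | top =>
    simp
  | coe a =>
    rw [← EReal.coe_sub, EReal.coe_le_coe_iff]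
    constructor
    · intro h t ht
      have := EReal.coe_le_coe_iff.1 ht
      linarith
    · intro h; exact h a le_rfl

lemma inner_sub_le_conjugate {f : H → EReal} {x : H} {t : ℝ} (h : f x ≤ (t : EReal)) (z : H) :
    ((inner ℝ z x - t : ℝ) : EReal) ≤ conjugate f z := by
  refine le_trans ?_ (le_iSup _ x)
  rw [EReal.coe_sub]
  exact EReal.sub_le_sub le_rfl h

lemma conjugate_ne_bot {f : H → EReal} (h : ∃ x, f x ≠ ⊤) (z : H) : conjugate f z ≠ ⊥ := by
  obtain ⟨x, hx⟩ := h
  obtain ⟨t, ht, -⟩ := EReal.lt_iff_exists_real_btwn.1 (lt_top_iff_ne_top.2 hx)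
  have := inner_sub_le_conjugate ht.le z
  intro hb
  rw [hb, le_bot_iff] at this
  exact EReal.coe_ne_bot _ this

lemma conjugate_antitone {f g : H → EReal} (h : ∀ x, f x ≤ g x) (z : H) :
    conjugate g z ≤ conjugate f z :=
  iSup_mono fun x => EReal.sub_le_sub le_rfl (h x)

/-- The epigraph of a conjugate is an intersection of half-spaces, one for each epigraph point of
`f`, so `f` itself may be arbitrary. -/
lemma convex_epigraph_conjugate (f : H → EReal) :
    Convex ℝ {p : H × ℝ | conjugate f p.1 ≤ (p.2 : EReal)} := by
  rintro ⟨z, c⟩ hz ⟨y, r⟩ hy a b ha hb hab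
  simp only [Set.mem_ofPred_eq, Prod.fst_add, Prod.snd_add, Prod.smul_fst, Prod.smul_snd,
    conjugate_le_coe_iff] at hz hy ⊢
  intro x s hs
  have e1 := hz x s hs
  have e2 := hy x s hs
  have e3 : inner ℝ (a • z + b • y) x = a * inner ℝ z x + b * inner ℝ y x := by
    rw [inner_add_left, inner_smul_left, inner_smul_left]; simp
  have e4 : s = a * s + b * s := by rw [← add_mul, hab, one_mul]
  rw [e3, smul_eq_mul, smul_eq_mul]
  nlinarith [mul_le_mul_of_nonneg_left e1 ha, mul_le_mul_of_nonneg_left e2 hb]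

/-- A point minimizing `½‖a - ·‖² + φ`, with `φ` convex, satisfies the subgradient inequality with
slope `a - z`. -/
lemma subgradient_of_prox {φ : H → EReal} (hφ : Convex ℝ {p : H × ℝ | φ p.1 ≤ (p.2 : EReal)})
    {a z : H} {c : ℝ} (hc : φ z ≤ (c : EReal))
    (hmin : ∀ (y : H) (r : ℝ), φ y ≤ (r : EReal) →
      1 / 2 * ‖a - z‖ ^ 2 + c ≤ 1 / 2 * ‖a - y‖ ^ 2 + r)
    {y : H} {r : ℝ} (hy : φ y ≤ (r : EReal)) :
    c + inner ℝ (a - z) (y - z) ≤ r := by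
  -- Compare `z` with the point at parameter `t` on the segment to `y`. After division by `t` the
  -- quadratic term is of order `t` and vanishes in the limit.
  have key : ∀ t : ℝ, 0 < t → t ≤ 1 →
      c + inner ℝ (a - z) (y - z) ≤ r + t * (1 / 2 * ‖y - z‖ ^ 2) := by
    intro t ht ht1
    have h1 := hφ (x := (z, c)) hc (y := (y, r)) hy (sub_nonneg.2 ht1) ht.le (by ring)
    have h2 := hmin ((1 - t) • z + t • y) ((1 - t) * c + t * r) (by simpa using h1)
    have e4 : ‖a - ((1 - t) • z + t • y)‖ ^ 2
        = ‖a - z‖ ^ 2 - 2 * t * inner ℝ (a - z) (y - z) + t ^ 2 * ‖y - z‖ ^ 2 := by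
      rw [show a - ((1 - t) • z + t • y) = (a - z) - t • (y - z) by module, norm_sub_sq_real,
        inner_smul_right, norm_smul, mul_pow, Real.norm_eq_abs, sq_abs]
      ring
    rw [e4] at h2
    have : 0 ≤ t * (r + t * (1 / 2 * ‖y - z‖ ^ 2) - (c + inner ℝ (a - z) (y - z))) := by
      nlinarith
    have := nonneg_of_mul_nonneg_right this ht
    linarith
  refine le_of_forall_pos_le_add fun ε hε => ?_
  set N : ℝ := 1 / 2 * ‖y - z‖ ^ 2 with hN
  have hN0 : 0 ≤ N := by positivity
  have ht : 0 < min 1 (ε / (N + 1)) := by positivity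
  refine (key _ ht (min_le_left _ _)).trans ?_
  have : min 1 (ε / (N + 1)) * N ≤ ε / (N + 1) * (N + 1) :=
    mul_le_mul (min_le_right _ _) (by linarith) hN0 (by positivity)
  rw [div_mul_cancel₀ _ (by positivity)] at this
  linarith

/-- Block minimizers of `½‖b - ∑ z‖² + ∑_{α ∈ S} f_α^*(z_α)`: the residual is a subgradient of each
conjugate in the block. -/
lemma conjugate_subgradient_of_block_min {ι : Type*} [Fintype ι] {F : ι → H → EReal}
    (hdom : ∀ α, ∃ x, F α x ≠ ⊤) {S : Finset ι} (hdual : ∀ α ∈ S, ∃ z, conjugate (F α) z ≠ ⊤)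
    {b : H} {z : ι → H}
    (hmin : ∀ y : ι → H, (∀ α, α ∉ S → y α = z α) →
      ((1 / 2 * ‖b - ∑ α, z α‖ ^ 2 : ℝ) : EReal) + ∑ α ∈ S, conjugate (F α) (z α) ≤
      ((1 / 2 * ‖b - ∑ α, y α‖ ^ 2 : ℝ) : EReal) + ∑ α ∈ S, conjugate (F α) (y α)) :
    ∀ α ∈ S, ∃ c : ℝ, conjugate (F α) (z α) = (c : EReal) ∧
      ∀ (y : H) (r : ℝ), conjugate (F α) y ≤ (r : EReal) →
        c + inner ℝ (b - ∑ β, z β) (y - z α) ≤ r := by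
  classical
  have hb : ∀ α y, conjugate (F α) y ≠ ⊥ := fun α y => conjugate_ne_bot (hdom α) y
  -- A competitor with finite conjugates on `S` exists, so the minimal value is finite.
  have hfin : ∀ α ∈ S, conjugate (F α) (z α) ≠ ⊤ := by
    choose! y hy using hdual
    have h1 := hmin (fun α => if α ∈ S then y α else z α) (by intro α hα; simp [hα])
    have h2 : ∑ α ∈ S, conjugate (F α) (if α ∈ S then y α else z α) ≠ ⊤ := by
      refine EReal.sum_ne_top_of_forall _ _ fun α hα => ?_
      simpa [hα] using hy α hα
    refine EReal.ne_top_of_sum_ne_top _ _ (fun α _ => hb α _) ?_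
    intro h3
    rw [h3, EReal.coe_add_top, top_le_iff] at h1
    exact EReal.add_ne_top (EReal.coe_ne_top _) h2 h1
  have hex : ∀ α, ∃ c : ℝ, α ∈ S → conjugate (F α) (z α) = (c : EReal) := by
    intro α
    by_cases hα : α ∈ S
    · obtain ⟨c, hc⟩ := EReal.exists_coe_of_ne (hb α _) (hfin α hα)
      exact ⟨c, fun _ => hc⟩
    · exact ⟨0, fun h => absurd h hα⟩
  choose c hc using hex
  intro α hα
  refine ⟨c α, hc α hα, fun y r hy => ?_⟩
  have hsum : ∀ y, ∑ β, Function.update z α y β = (∑ β, z β) - z α + y := by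
    intro y
    rw [Finset.sum_update_of_mem (Finset.mem_univ α), ← Finset.add_sum_erase _ _ (Finset.mem_univ α),
      Finset.sdiff_singleton_eq_erase]
    abel
  -- With the other blocks frozen, `z α` is a proximal point with center `b` minus the sum of the
  -- other blocks.
  have hsub := subgradient_of_prox (convex_epigraph_conjugate (F α))
    (a := b - (∑ β, z β - z α)) (hc α hα).le ?_ hy
  · rwa [show b - (∑ β, z β - z α) - z α = b - ∑ β, z β by abel] at hsub
  · intro y r hy
    have h1 := hmin (Function.update z α y) (by
      intro β hβ
      rw [Function.update_of_ne]
      rintro rfl; exact hβ hα)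
    rw [← Finset.add_sum_erase _ _ hα, ← Finset.add_sum_erase _ _ hα, hsum, hc α hα,
      Function.update_self] at h1
    have e1 : ∀ w : ι → H, (∀ β ∈ S.erase α, w β = z β) →
        ∑ β ∈ S.erase α, conjugate (F β) (w β) = ((∑ β ∈ S.erase α, c β : ℝ) : EReal) := by
      intro w hw
      rw [← EReal.sum_coe]
      refine Finset.sum_congr rfl fun β hβ => ?_
      rw [hw β hβ, hc β (Finset.mem_of_mem_erase hβ)]
    rw [e1 z (fun _ _ => rfl), e1 (Function.update z α y) (fun β hβ =>
      Function.update_of_ne (Finset.ne_of_mem_erase hβ) _ _)] at h1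
    have h2 := h1.trans (add_le_add le_rfl (add_le_add hy le_rfl))
    norm_cast at h2
    rw [show b - (∑ β, z β - z α) - z α = b - ∑ β, z β by abel,
      show b - (∑ β, z β - z α) - y = b - (∑ β, z β - z α + y) by abel]
    linarith

/-- A proper closed convex function has an affine minorant. -/
lemma IsClosedConvexFn.exists_conjugate_ne_top [CompleteSpace H] {f : H → EReal}
    (hf : IsClosedConvexFn f) (hd : ∃ x, f x ≠ ⊤) : ∃ z, conjugate f z ≠ ⊤ := by
  obtain ⟨hbot, hlsc, hcv⟩ := hf
  obtain ⟨x0, hx0⟩ := hd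
  obtain ⟨a, ha⟩ := EReal.exists_coe_of_ne (hbot x0) hx0
  have hcl : IsClosed {p : H × ℝ | f p.1 ≤ (p.2 : EReal)} := by
    have := (lowerSemicontinuous_iff_isClosed_epigraph).1 hlsc
    exact this.preimage (f := fun p : H × ℝ => ((p.1, (p.2 : EReal)) : H × EReal))
      (continuous_fst.prodMk (continuous_coe_real_ereal.comp continuous_snd))
  -- Separate a point just below the graph from the epigraph. Comparing with `(x0, a)` above it
  -- shows that the vertical coefficient `l` is positive, so the hyperplane is the graph of an
  -- affine minorant.
  obtain ⟨L, u, hL1, hL2⟩ := geometric_hahn_banach_point_closed (x := (x0, a - 1)) hcv hcl (by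
    simp only [Set.mem_ofPred_eq, ha, EReal.coe_le_coe_iff]; linarith)
  set l : ℝ := L (0, 1) with hl
  have hLd : ∀ (x : H) (t : ℝ), L (x, t) = L (x, 0) + t * l := by
    intro x t
    rw [hl, ← smul_eq_mul, ← map_smul, ← map_add]
    simp
  have h0 := hL2 (x0, a) (by simp [ha])
  rw [hLd] at h0 hL1
  have hlpos : 0 < l := by nlinarith
  set M : H →L[ℝ] ℝ := L.comp (ContinuousLinearMap.inl ℝ H ℝ) with hM
  refine ⟨-(l⁻¹ • (InnerProductSpace.toDual ℝ H).symm M), ?_⟩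
  refine ne_top_of_le_ne_top (EReal.coe_ne_top (-(l⁻¹ * u))) ?_
  rw [conjugate_le_coe_iff]
  intro x t hxt
  have h1 := hL2 (x, t) hxt
  rw [hLd] at h1
  rw [inner_neg_left, inner_smul_left, InnerProductSpace.toDual_symm_apply]
  have h2 : M x = L (x, 0) := rfl
  rw [h2]
  have h3 : l⁻¹ * u < l⁻¹ * (L (x, 0) + t * l) := mul_lt_mul_of_pos_left h1 (inv_pos.2 hlpos)
  have h4 : l⁻¹ * (L (x, 0) + t * l) = l⁻¹ * L (x, 0) + t := by field_simp
  simp only [conj_trivial]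
  linarith

end Conjugate

/-! ### The linearized step at a single node -/

section SubgradientStep

variable {m : ℕ}

/-- The linearization error of a function with `1/σ`-Lipschitz gradient. -/
lemma le_linearization_add_sq {g : Block m → ℝ} {σ : ℝ} (hσ : 0 < σ) (hd : Differentiable ℝ g)
    (hL : ∀ x y, ‖gradient g x - gradient g y‖ ≤ (1 / σ) * ‖x - y‖) {q s : Block m}
    (hs : ∀ y, g q + inner ℝ s (y - q) ≤ g y) (x : Block m) :
    g x ≤ g q + inner ℝ s (x - q) + 1 / σ * ‖x - q‖ ^ 2 := by
  set h : Block m → ℝ := fun y => g y - inner ℝ s y with hh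
  have hder : ∀ y, HasFDerivAt h (InnerProductSpace.toDual ℝ (Block m) (gradient g y - s)) y := by
    intro y
    have h1 := (hd y).hasGradientAt.hasFDerivAt
    have h2 := (InnerProductSpace.toDual ℝ (Block m) s).hasFDerivAt (x := y)
    rw [map_sub]
    exact h1.sub h2
  -- A subgradient of a differentiable function is its gradient: `q` minimizes `h`.
  have hq : gradient g q = s := by
    have hmin : IsLocalMin h q := by
      refine Filter.Eventually.of_forall fun y => ?_
      have := hs y
      simp only [hh]
      rw [inner_sub_right] at this
      linarith
    have := hmin.hasFDerivAt_eq_zero (hder q)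
    rw [← map_zero (InnerProductSpace.toDual ℝ (Block m))] at this
    exact sub_eq_zero.1 ((InnerProductSpace.toDual ℝ (Block m)).injective this)
  -- The mean value inequality on this ball yields the constant `1 / σ`; the sharp `1 / (2σ)` is not
  -- needed.
  have hb : ∀ y ∈ Metric.closedBall q ‖x - q‖,
      ‖InnerProductSpace.toDual ℝ (Block m) (gradient g y - s)‖ ≤ 1 / σ * ‖x - q‖ := by
    intro y hy
    rw [LinearIsometryEquiv.norm_map, ← hq]
    refine (hL y q).trans (mul_le_mul_of_nonneg_left ?_ (by positivity))
    rwa [← dist_eq_norm]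
  have := (convex_closedBall q ‖x - q‖).norm_image_sub_le_of_norm_hasFDerivWithin_le
    (fun y _ => (hder y).hasFDerivWithinAt) hb (Metric.mem_closedBall_self (norm_nonneg _))
    (y := x) (by rw [Metric.mem_closedBall, dist_eq_norm])
  have h3 := (Real.le_norm_self _).trans this
  simp only [hh] at h3
  rw [inner_sub_right]
  nlinarith

/-- Testing along multiples of `z - s` makes the supremum infinite unless `z = s`. Hence an affine
model pins its dual block to its slope. -/
lemma conjugate_affine_le_iff {H : Type*} [NormedAddCommGroup H] [InnerProductSpace ℝ H]
    {g : H → EReal} {c : ℝ} {s : H}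
    (hg : ∀ x, g x = ((c + inner ℝ s x : ℝ) : EReal)) {z : H} {r : ℝ} :
    conjugate g z ≤ (r : EReal) ↔ z = s ∧ -c ≤ r := by
  rw [conjugate_le_coe_iff]
  constructor
  · intro h
    have h0 : ∀ t : ℝ, t * ‖z - s‖ ^ 2 ≤ r + c := by
      intro t
      have := h (t • (z - s)) _ (hg _).le
      rw [← real_inner_self_eq_norm_sq, inner_sub_left]
      rw [inner_smul_right, inner_smul_right] at this
      linarith
    refine ⟨?_, by linarith [h0 0]⟩
    by_contra hne
    have hpos : 0 < ‖z - s‖ ^ 2 := by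
      have := norm_pos_iff.2 (sub_ne_zero.2 hne)
      positivity
    have := h0 ((r + c + 1) / ‖z - s‖ ^ 2)
    rw [div_mul_cancel₀ _ hpos.ne'] at this
    linarith
  · rintro ⟨rfl, hr⟩ x t hxt
    rw [hg, EReal.coe_le_coe_iff] at hxt
    linarith

lemma conjugate_affine_self {H : Type*} [NormedAddCommGroup H] [InnerProductSpace ℝ H]
    {g : H → EReal} {c : ℝ} {s : H}
    (hg : ∀ x, g x = ((c + inner ℝ s x : ℝ) : EReal)) : conjugate g s = ((-c : ℝ) : EReal) := by
  refine le_antisymm ((conjugate_affine_le_iff hg).2 ⟨rfl, le_rfl⟩) ?_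
  have := inner_sub_le_conjugate (hg 0).le s
  simpa using this

/-- Since `p - xp` is a subgradient of `M` at `xp`, duality forces `z' = p - xp`, and `g'` supports
`M` at `xp` with slope `z'`. The last two conclusions are the Fenchel–Young inequality for `g` and
for `f` at `xp`: `g ≤ M` gives descent, while `f` exceeds `M` at `xp` by at most the linearization
error, which gives the anchor for the true conjugate. -/
lemma SubgradientStep.spec {f g g' : Block m → EReal} {fr gr : Block m → ℝ} {q p z' : Block m}
    (h : SubgradientStep f g q p g' z') (hf : ∀ x, f x = (fr x : EReal))
    (hg : ∀ x, g x = (gr x : EReal)) (hgc : ConvexOn ℝ Set.univ gr) (hgf : ∀ x, g x ≤ f x) :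
    ∃ c : ℝ, (∀ x, g' x = ((c + inner ℝ z' x : ℝ) : EReal)) ∧ (∀ x, g' x ≤ f x) ∧
      (∀ (y : Block m) (r : ℝ), conjugate g y ≤ (r : EReal) →
        -c + inner ℝ (p - z') (y - z') ≤ r) ∧
      ∀ σ : ℝ, 0 < σ → Differentiable ℝ fr →
        (∀ x y, ‖gradient fr x - gradient fr y‖ ≤ (1 / σ) * ‖x - y‖) →
        ∀ (y : Block m) (r : ℝ), conjugate f y ≤ (r : EReal) →
          -c + inner ℝ (p - z') (y - z') ≤ r + 1 / σ * ‖(p - z') - q‖ ^ 2 := by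
  obtain ⟨s, ⟨-, hs⟩, M, hM, xp, hxp, hz', hg'⟩ := h
  set Mr : Block m → ℝ := fun x => max (gr x) (fr q + inner ℝ s (x - q)) with hMr
  have hMM : ∀ x, M x = (Mr x : EReal) := by
    intro x
    rw [hM, hg, hf, ← EReal.coe_add, hMr]
    exact (EReal.coe_strictMono.monotone.map_max).symm
  have hs' : ∀ y, fr q + inner ℝ s (y - q) ≤ fr y := by
    intro y
    have := hs y
    rw [hf, hf] at this
    exact_mod_cast this
  have hMf : ∀ x, Mr x ≤ fr x := by
    intro x
    have h1 := hgf x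
    rw [hg, hf, EReal.coe_le_coe_iff] at h1
    exact max_le h1 (hs' x)
  have hMc : Convex ℝ {p : Block m × ℝ | M p.1 ≤ (p.2 : EReal)} := by
    have h1 : ConvexOn ℝ Set.univ Mr := by
      refine hgc.sup ⟨convex_univ, fun x _ y _ a b _ _ hab => le_of_eq ?_⟩
      have : a • x + b • y - q = a • (x - q) + b • (y - q) := by
        rw [smul_sub, smul_sub, sub_add_sub_comm, ← add_smul, hab, one_smul]
      beta_reduce
      rw [this, inner_add_right, inner_smul_right, inner_smul_right, smul_eq_mul, smul_eq_mul]
      linear_combination (-fr q) * hab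
    simpa [hMM] using h1.convex_epigraph
  have hsubg : ∀ y, Mr xp + inner ℝ (p - xp) (y - xp) ≤ Mr y := by
    intro y
    refine subgradient_of_prox hMc (hMM xp).le ?_ (hMM y).le
    intro y r hy
    have h1 := (hxp y).trans (add_le_add le_rfl hy)
    rw [hMM] at h1
    exact_mod_cast h1
  -- Fenchel equality bounds `conjugate M` above at `p - xp`, Fenchel–Young bounds it below at `z'`;
  -- minimality of `z'` then leaves `‖(p - xp) - z'‖ ^ 2 ≤ 0`.
  have hz : z' = p - xp := by
    have h1 : conjugate M (p - xp) ≤ ((inner ℝ (p - xp) xp - Mr xp : ℝ) : EReal) := by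
      rw [conjugate_le_coe_iff]
      intro x t hxt
      rw [hMM, EReal.coe_le_coe_iff] at hxt
      have := hsubg x
      rw [inner_sub_right] at this
      linarith
    have h2 := inner_sub_le_conjugate (hMM xp).le z'
    have h3 := (add_le_add le_rfl h2).trans ((hz' (p - xp)).trans (add_le_add le_rfl h1))
    norm_cast at h3
    have e1 : ‖p - z'‖ ^ 2 = ‖xp‖ ^ 2 + 2 * inner ℝ xp ((p - xp) - z') + ‖(p - xp) - z'‖ ^ 2 := by
      rw [← norm_add_sq_real]; congr 2; abel
    rw [e1, inner_sub_right, show p - (p - xp) = xp by abel, real_inner_comm xp z',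
      real_inner_comm xp (p - xp)] at h3
    rw [real_inner_comm (p - xp) xp, real_inner_comm z' xp] at h3
    have h4 : ‖(p - xp) - z'‖ ^ 2 ≤ 0 := by linarith
    have h5 : ‖(p - xp) - z'‖ = 0 := by
      have := norm_nonneg ((p - xp) - z'); nlinarith
    exact (sub_eq_zero.1 (norm_eq_zero.1 h5)).symm
  have hpz : p - z' = xp := by rw [hz]; abel
  have hval : ∀ x, g' x = ((Mr xp - inner ℝ z' xp + inner ℝ z' x : ℝ) : EReal) := by
    intro x
    rw [hg', hMM, ← EReal.coe_add, ← hz, inner_sub_left, real_inner_comm xp z',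
      real_inner_comm x z']
    congr 1
    ring
  refine ⟨Mr xp - inner ℝ z' xp, hval, ?_, ?_, ?_⟩
  · intro x
    rw [hval, hf, EReal.coe_le_coe_iff]
    have := (hsubg x).trans (hMf x)
    rw [← hz, inner_sub_right] at this
    linarith
  · intro y r hy
    have h1 := conjugate_le_coe_iff.1 hy xp _ (hg xp).le
    have h2 : gr xp ≤ Mr xp := le_max_left _ _
    rw [hpz, inner_sub_right, real_inner_comm y xp, real_inner_comm z' xp]
    linarith
  · intro σ hσ hd hL y r hy
    have h1 := conjugate_le_coe_iff.1 hy xp _ (hf xp).le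
    have h2 : fr q + inner ℝ s (xp - q) ≤ Mr xp := le_max_right _ _
    have h3 := le_linearization_add_sq hσ hd hL hs' xp
    rw [hpz, inner_sub_right, real_inner_comm y xp, real_inner_comm z' xp]
    linarith

end SubgradientStep

/-! ### Conjugates of subspace indicators and of single-block functions -/

section ConjugateFormulas

lemma conjugate_indicatorFn_le_iff {H : Type*} [NormedAddCommGroup H] [InnerProductSpace ℝ H]
    {K : Submodule ℝ H} {z : H} {r : ℝ} :
    conjugate (indicatorFn (K : Set H)) z ≤ (r : EReal) ↔ z ∈ Kᗮ ∧ 0 ≤ r := by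
  rw [conjugate_le_coe_iff]
  constructor
  · intro h
    have h0 : ∀ x ∈ K, inner ℝ z x ≤ r := by
      intro x hx
      simpa using h x 0 (by simp [indicatorFn, hx])
    refine ⟨?_, by simpa using h0 0 K.zero_mem⟩
    rw [Submodule.mem_orthogonal']
    intro x hx
    by_contra hne
    have := h0 (((r + 1) / inner ℝ z x) • x) (K.smul_mem _ hx)
    rw [inner_smul_right, div_mul_cancel₀ _ hne] at this
    linarith
  · rintro ⟨hz, hr⟩ x t hxt
    by_cases hx : x ∈ K
    · have : (0 : EReal) ≤ (t : EReal) := by simpa [indicatorFn, hx] using hxt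
      have := EReal.coe_nonneg.1 this
      rw [(Submodule.mem_orthogonal' K z).1 hz x hx]
      linarith
    · simp [indicatorFn, hx] at hxt

lemma conjugate_indicatorFn_of_mem {H : Type*} [NormedAddCommGroup H] [InnerProductSpace ℝ H]
    {K : Submodule ℝ H} {z : H} (hz : z ∈ Kᗮ) : conjugate (indicatorFn (K : Set H)) z = 0 := by
  refine le_antisymm ?_ ?_
  · simpa using (conjugate_indicatorFn_le_iff (r := 0)).2 ⟨hz, le_rfl⟩
  · have := inner_sub_le_conjugate (f := indicatorFn (K : Set H)) (x := 0) (t := 0)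
      (by simp [indicatorFn]) z
    simpa using this

lemma exists_indicatorFn_ne_top {H : Type*} [NormedAddCommGroup H] [InnerProductSpace ℝ H]
    (K : Submodule ℝ H) : ∃ x, indicatorFn (K : Set H) x ≠ ⊤ := ⟨0, by simp [indicatorFn]⟩

lemma mem_orthogonal_of_conjugate_ne_top {H : Type*} [NormedAddCommGroup H]
    [InnerProductSpace ℝ H] {K : Submodule ℝ H} {z : H}
    (h : conjugate (indicatorFn (K : Set H)) z ≠ ⊤) : z ∈ Kᗮ := by
  obtain ⟨r, hr⟩ := EReal.exists_coe_of_ne (conjugate_ne_bot (exists_indicatorFn_ne_top K) z) h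
  exact (conjugate_indicatorFn_le_iff.1 hr.le).1

variable {V : Type*} [Fintype V] {m : ℕ}

lemma inner_eq_of_sparse {z : NodeProd V m} {i : V} (hz : ∀ j, j ≠ i → z j = 0)
    (x : NodeProd V m) : inner ℝ z x = inner ℝ (z i) (x i) := by
  rw [PiLp.inner_apply]
  refine Finset.sum_eq_single i (fun j _ hj => ?_) (by simp)
  rw [hz j hj, inner_zero_left]

lemma conjugate_boldFn_inl_of_sparse (G : SimpleGraph V) {g : V → Block m → EReal} {i : V}
    {z : NodeProd V m} (hz : ∀ j, j ≠ i → z j = 0) :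
    conjugate (boldFn G m g (Sum.inl i)) z = conjugate (g i) (z i) := by
  classical
  have hs : Function.Surjective fun x : NodeProd V m => x i := fun b =>
    ⟨WithLp.toLp 2 fun _ => b, rfl⟩
  unfold conjugate
  rw [← hs.iSup_comp]
  simp only [boldFn, inner_eq_of_sparse hz]

/-- The function sees only block `i`, so moving by `s • z j` in the other blocks costs nothing while
the pairing grows like `s * N`. -/
lemma sparse_of_conjugate_boldFn_ne_top (G : SimpleGraph V) {g : V → Block m → EReal} {i : V}
    (hd : ∃ x, g i x ≠ ⊤) {z : NodeProd V m}
    (hz : conjugate (boldFn G m g (Sum.inl i)) z ≠ ⊤) : ∀ j, j ≠ i → z j = 0 := by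
  classical
  obtain ⟨x0, hx0⟩ := hd
  have hd' : ∃ x, boldFn G m g (Sum.inl i) x ≠ ⊤ := ⟨WithLp.toLp 2 fun _ => x0, hx0⟩
  obtain ⟨r, hr⟩ := EReal.exists_coe_of_ne (conjugate_ne_bot hd' z) hz
  obtain ⟨t, ht, -⟩ := EReal.lt_iff_exists_real_btwn.1 (lt_top_iff_ne_top.2 hx0)
  have h := conjugate_le_coe_iff.1 hr.le
  set N : ℝ := ∑ j ∈ Finset.univ.erase i, ‖z j‖ ^ 2 with hN
  have h1 : ∀ s : ℝ, inner ℝ (z i) x0 + s * N - t ≤ r := by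
    intro s
    have := h (WithLp.toLp 2 (Function.update (fun k => s • z k) i x0)) t (by
      simpa [boldFn] using ht.le)
    rw [PiLp.inner_apply, ← Finset.add_sum_erase _ _ (Finset.mem_univ i)] at this
    have e : ∑ j ∈ Finset.univ.erase i,
        inner ℝ (z j) ((WithLp.toLp 2 (Function.update (fun k => s • z k) i x0)).ofLp j)
        = s * N := by
      rw [hN, Finset.mul_sum]
      refine Finset.sum_congr rfl fun j hj => ?_
      simp only [Function.update_of_ne (Finset.ne_of_mem_erase hj)]
      rw [inner_smul_right, real_inner_self_eq_norm_sq]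
    rw [e] at this
    simpa using this
  have hN0 : N = 0 := by
    by_contra hne
    have := h1 ((r + t - inner ℝ (z i) x0 + 1) / N)
    rw [div_mul_cancel₀ _ hne] at this
    linarith
  intro j hj
  have := (Finset.sum_eq_zero_iff_of_nonneg (fun _ _ => by positivity)).1 hN0 j (by simp [hj])
  simpa using this

end ConjugateFormulas

/-! ### Linear regularity of the edge subspaces -/

section Geometry

/-- Linear regularity of finitely many subspaces: a point close to each `K α`, `α ∈ E'`, is nearly
orthogonal to `(⨅ α, K α)ᗮ` whenever `⨅ α ∈ E', K α = ⨅ α, K α`. -/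
lemma exists_inner_le_of_near_subspaces {X ι : Type*} [NormedAddCommGroup X]
    [InnerProductSpace ℝ X] [FiniteDimensional ℝ X] [Fintype ι] (K : ι → Submodule ℝ X)
    (E' : Set ι) (hE' : (⨅ α ∈ E', K α) = ⨅ α, K α) :
    ∃ C : ℝ, 0 ≤ C ∧ ∀ (x v : X) (ε : ℝ), 0 ≤ ε → v ∈ (⨅ α, K α)ᗮ →
      (∀ α ∈ E', ∃ p ∈ K α, ‖x - p‖ ≤ ε) → |inner ℝ x v| ≤ C * ε * ‖v‖ := by
  classical
  set D := ⨅ α, K α with hD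
  -- `T` stacks the projections onto the complements of `K α`, `α ∈ E'`. By `hE'` its kernel is `D`,
  -- so it is injective on `Dᗮ`, hence bounded below there by finite dimension.
  set T : X →ₗ[ℝ] (ι → X) := LinearMap.pi fun α =>
    if α ∈ E' then ((K α)ᗮ.starProjection : X →ₗ[ℝ] X) else 0 with hT
  have hTapp : ∀ x α, α ∈ E' → T x α = (K α)ᗮ.starProjection x := by
    intro x α hα; simp [hT, hα]
  have hTapp' : ∀ x α, α ∉ E' → T x α = 0 := by
    intro x α hα; simp [hT, hα]
  have hker : ∀ x, T x = 0 → x ∈ D := by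
    intro x hx
    simp only [← hE', Submodule.mem_iInf]
    intro α hα
    have h1 : (K α)ᗮ.starProjection x = 0 := by rw [← hTapp x α hα, hx]; rfl
    rw [Submodule.starProjection_apply_eq_zero_iff, Submodule.orthogonal_orthogonal] at h1
    exact h1
  have hzero : ∀ x ∈ D, T x = 0 := by
    intro x hx
    funext α
    by_cases hα : α ∈ E'
    · rw [hTapp x α hα, Pi.zero_apply, Submodule.starProjection_apply_eq_zero_iff,
        Submodule.orthogonal_orthogonal]
      exact (Submodule.mem_iInf _).1 hx α
    · rw [hTapp' x α hα]; rfl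
  obtain ⟨C, -, hC⟩ := (T.comp Dᗮ.subtype).exists_antilipschitzWith (by
    rw [LinearMap.ker_eq_bot']
    rintro ⟨x, hx⟩ h0
    have : x ∈ D ⊓ Dᗮ := ⟨hker x h0, hx⟩
    rw [Submodule.inf_orthogonal_eq_bot, Submodule.mem_bot] at this
    exact Subtype.ext this)
  refine ⟨C, C.2, fun x v ε hε hv hx => ?_⟩
  set u : Dᗮ := ⟨x - D.starProjection x, Submodule.sub_starProjection_mem_orthogonal x⟩ with hu
  have h1 : ‖(u : X)‖ ≤ C * ‖T u‖ := by
    have := hC.le_mul_dist u 0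
    simpa [dist_eq_norm] using this
  have h2 : T u = T x := by
    rw [hu]
    simp only [map_sub]
    rw [hzero _ (Submodule.starProjection_apply_mem D x), sub_zero]
  have h3 : ‖T x‖ ≤ ε := by
    rw [pi_norm_le_iff_of_nonneg hε]
    intro α
    by_cases hα : α ∈ E'
    · obtain ⟨p, hp, hpε⟩ := hx α hα
      have e : (K α)ᗮ.starProjection x = (K α)ᗮ.starProjection (x - p) := by
        have : (K α)ᗮ.starProjection p = 0 := by
          rw [Submodule.starProjection_apply_eq_zero_iff, Submodule.orthogonal_orthogonal]
          exact hp
        rw [map_sub, this, sub_zero]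
      rw [hTapp x α hα, e]
      exact (Submodule.norm_starProjection_apply_le _ _).trans hpε
    · rw [hTapp' x α hα, norm_zero]; exact hε
  have h4 : inner ℝ x v = inner ℝ (u : X) v := by
    have : inner ℝ (D.starProjection x) v = 0 :=
      (Submodule.mem_orthogonal D v).1 hv _ (Submodule.starProjection_apply_mem D x)
    rw [hu]
    simp only [inner_sub_left]
    rw [this, sub_zero]
  rw [h4]
  refine (abs_real_inner_le_norm _ _).trans (mul_le_mul_of_nonneg_right ?_ (norm_nonneg _))
  rw [h2] at h1
  exact h1.trans (mul_le_mul_of_nonneg_left h3 C.2)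

/-- The set of edges in use changes from cycle to cycle, but there are only finitely many subsets,
so one constant serves them all. -/
lemma exists_uniform_inner_le_of_near_subspaces {X ι : Type*} [NormedAddCommGroup X]
    [InnerProductSpace ℝ X] [FiniteDimensional ℝ X] [Fintype ι] (K : ι → Submodule ℝ X) :
    ∃ C : ℝ, 0 ≤ C ∧ ∀ E' : Set ι, (⨅ α ∈ E', K α) = ⨅ α, K α →
      ∀ (x v : X) (ε : ℝ), 0 ≤ ε → v ∈ (⨅ α, K α)ᗮ →
      (∀ α ∈ E', ∃ p ∈ K α, ‖x - p‖ ≤ ε) → |inner ℝ x v| ≤ C * ε * ‖v‖ := by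
  choose! c hc0 hc using exists_inner_le_of_near_subspaces K
  obtain ⟨C, hC⟩ := (Set.finite_range c).bddAbove
  refine ⟨max C 0, le_max_right _ _, fun E' hE' x v ε hε hv hx => ?_⟩
  refine (hc E' hE' x v ε hε hv hx).trans ?_
  have : c E' ≤ max C 0 := (hC ⟨E', rfl⟩).trans (le_max_left _ _)
  gcongr

end Geometry

/-! ### The O(1/n) recursion -/

section RealSequence

/-- Induction on `h n * n ≤ C`. If the bound failed at `n + 1`, the recursion times `n` would give
`h (n + 1) * n < K`, so `h (n + 1) * (n + 1) < 2 * K ≤ C`. The summand `2 * h 2` of `C` settles the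
start at 2. -/
lemma exists_le_div_of_sq_le {h : ℕ → ℝ} {K : ℝ} (hK : 0 ≤ K) (h0 : ∀ n ≥ 2, 0 ≤ h n)
    (hrec : ∀ n ≥ 2, h (n + 1) ^ 2 ≤ K * (h n - h (n + 1))) :
    ∃ C : ℝ, ∀ n ≥ 2, h n ≤ C / n := by
  refine ⟨2 * h 2 + 2 * K, fun n hn => ?_⟩
  set C := 2 * h 2 + 2 * K with hC
  induction n, hn using Nat.le_induction with
  | base =>
    rw [le_div_iff₀ (by norm_num)]
    push_cast
    linarith
  | succ n hn ih =>
    have hn' : (2 : ℝ) ≤ n := by exact_mod_cast hn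
    by_contra! hlt
    push_cast at hlt
    rw [div_lt_iff₀ (by positivity)] at hlt
    rw [le_div_iff₀ (by positivity)] at ih
    have h1 := hrec n hn
    have h2 := h0 (n + 1) (by omega)
    have h3 := h0 2 le_rfl
    rcases hK.eq_or_lt with rfl | hKpos
    · have : h (n + 1) = 0 := by nlinarith
      rw [this] at hlt
      linarith
    · have hpos : 0 < h (n + 1) := by
        rcases h2.eq_or_lt with h4 | h4
        · rw [← h4] at hlt; linarith
        · exact h4
      have h5 : h (n + 1) ^ 2 * n ≤ K * (C - h (n + 1) * n) := by nlinarith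
      have h6 : K * (C - h (n + 1) * n) < K * h (n + 1) :=
        mul_lt_mul_of_pos_left (by linarith) hKpos
      have h7 : h (n + 1) * n < K := by
        by_contra! h8
        nlinarith
      nlinarith

end RealSequence

/-! ### Boundedness of node blocks from the constraint qualification -/

section Recession

variable {V : Type*} [Fintype V] {m : ℕ}

/-- Under the constraint qualification the dual node blocks with bounded sum and bounded dual value
are bounded. -/
lemma ConstraintQualification.exists_norm_le {kind : V → NodeKind} {f : V → Block m → EReal}
    {xstar : Block m} (hcq : ConstraintQualification kind f xstar)
    (hbot : ∀ i x, f i x ≠ ⊥) (hx : ∀ i, f i xstar ≠ ⊤)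
    (hfull : ∀ i, ¬ (kind i = .proximable ∨ kind i = .indicator) → ∀ x, f i x ≠ ⊤)
    (K₁ K₂ : ℝ) :
    ∃ B : ℝ, ∀ (u : V → Block m) (c : V → ℝ), ‖∑ i, u i‖ ≤ K₁ →
      (∀ i, conjugate (f i) (u i) ≤ (c i : EReal)) → ∑ i, c i ≤ K₂ → ∀ i, ‖u i‖ ≤ B := by
  classical
  by_contra! hcon
  choose u c hu1 hu2 hu3 j hj using fun n : ℕ => hcon n
  have hnorm : ∀ n : ℕ, (n : ℝ) < ‖u n‖ := fun n => (hj n).trans_le (norm_le_pi_norm (u n) (j n))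
  have hpos : ∀ n : ℕ, 0 < ‖u n‖ := fun n => (Nat.cast_nonneg n).trans_lt (hnorm n)
  have htop : Filter.Tendsto (fun n => ‖u n‖) Filter.atTop Filter.atTop :=
    Filter.tendsto_atTop_mono (fun n => (hnorm n).le) tendsto_natCast_atTop_atTop
  -- Normalize an unbounded family; a limit `y` of norm one will contradict the constraint
  -- qualification.
  set w : ℕ → V → Block m := fun n => ‖u n‖⁻¹ • u n with hw
  have hw1 : ∀ n, w n ∈ Metric.sphere (0 : V → Block m) 1 := by
    intro n
    rw [mem_sphere_zero_iff_norm, hw]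
    simp only [norm_smul, norm_inv, norm_norm]
    exact inv_mul_cancel₀ (hpos n).ne'
  obtain ⟨y, hy1, φ, hφ, hlim⟩ := (isCompact_sphere (0 : V → Block m) 1).tendsto_subseq hw1
  have hinv : ∀ K : ℝ, Filter.Tendsto (fun n => ‖u (φ n)‖⁻¹ * K) Filter.atTop (nhds 0) := by
    intro K
    simpa using ((tendsto_inv_atTop_zero.comp (htop.comp hφ.tendsto_atTop)).mul_const K)
  have hlimi : ∀ i, Filter.Tendsto (fun n => w (φ n) i) Filter.atTop (nhds (y i)) :=
    fun i => (tendsto_pi_nhds.1 hlim) i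
  have hsum : ∑ i, y i = 0 := by
    have h1 : Filter.Tendsto (fun n => ‖∑ i, w (φ n) i‖) Filter.atTop (nhds ‖∑ i, y i‖) :=
      (tendsto_finsetSum _ fun i _ => hlimi i).norm
    have h2 : ‖∑ i, y i‖ ≤ 0 := by
      refine le_of_tendsto_of_tendsto' h1 (hinv K₁) fun n => ?_
      simp only [hw, Pi.smul_apply]
      rw [← Finset.smul_sum, norm_smul, norm_inv, norm_norm]
      exact mul_le_mul_of_nonneg_left (hu1 _) (by positivity)
    simpa using h2
  -- Divide the summed Fenchel–Young inequalities by `‖u‖`: the bounded terms disappear in the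
  -- limit. The points `x i` may differ from node to node.
  have hrec : ∀ x : V → Block m, (∀ i, f i (x i) ≠ ⊤) → ∑ i, inner ℝ (y i) (x i) ≤ 0 := by
    intro x hxt
    have ht : ∀ i, ∃ t : ℝ, f i (x i) = (t : EReal) := fun i =>
      EReal.exists_coe_of_ne (hbot _ _) (hxt i)
    choose t ht using ht
    have h1 : Filter.Tendsto (fun n => ∑ i, inner ℝ (w (φ n) i) (x i)) Filter.atTop
        (nhds (∑ i, inner ℝ (y i) (x i))) :=
      tendsto_finsetSum _ fun i _ => (hlimi i).inner tendsto_const_nhds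
    refine le_of_tendsto_of_tendsto' h1 (hinv (K₂ + ∑ i, t i)) fun n => ?_
    simp only [hw, Pi.smul_apply, inner_smul_left, conj_trivial]
    rw [← Finset.mul_sum]
    refine mul_le_mul_of_nonneg_left ?_ (by positivity)
    have h2 : ∑ i, inner ℝ (u (φ n) i) (x i) ≤ ∑ i, (c (φ n) i + t i) := by
      refine Finset.sum_le_sum fun i _ => ?_
      have := conjugate_le_coe_iff.1 (hu2 (φ n) i) (x i) (t i) (ht i).le
      linarith
    rw [Finset.sum_add_distrib] at h2
    linarith [hu3 (φ n)]
  -- Move only node `i` away from `xstar`; as the `y i` sum to zero, this is the normal cone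
  -- inequality.
  have hone : ∀ i (d : Block m), f i d ≠ ⊤ → inner ℝ (y i) (d - xstar) ≤ 0 := by
    intro i d hd
    have h1 := hrec (Function.update (fun _ => xstar) i d) (by
      intro k
      by_cases hk : k = i
      · subst hk; simpa using hd
      · simpa [hk] using hx k)
    have h2 : ∑ k, inner ℝ (y k) (Function.update (fun _ => xstar) i d k)
        = ∑ k, inner ℝ (y k) xstar + inner ℝ (y i) (d - xstar) := by
      rw [← Finset.add_sum_erase _ _ (Finset.mem_univ i),
        ← Finset.add_sum_erase _ (fun k => inner ℝ (y k) xstar) (Finset.mem_univ i),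
        Finset.sum_congr rfl fun k hk => by
          rw [Function.update_of_ne (Finset.ne_of_mem_erase hk)], Function.update_self,
        inner_sub_right]
      ring
    rw [h2, ← sum_inner, hsum, inner_zero_left] at h1
    linarith
  have hzero' : ∀ i, ¬ (kind i = .proximable ∨ kind i = .indicator) → y i = 0 := by
    intro i hi
    have := hone i (xstar + y i) (hfull i hi _)
    rw [add_sub_cancel_left, real_inner_self_eq_norm_sq] at this
    have h2 : ‖y i‖ ^ 2 = 0 := le_antisymm this (by positivity)
    simpa using h2
  have hzero : ∀ i, kind i = .proximable ∨ kind i = .indicator → y i = 0 := by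
    refine hcq y (fun i _ => ?_) ?_
    · have hcl : IsClosed {d : Block m | inner ℝ (y i) (d - xstar) ≤ 0} :=
        isClosed_le (by fun_prop) continuous_const
      exact fun d hd => closure_minimal (fun d hd => hone i d (lt_top_iff_ne_top.1 hd)) hcl hd
    · refine (Finset.sum_filter _ _).trans ((Finset.sum_congr rfl fun i _ => ?_).trans hsum)
      split_ifs with h
      · rfl
      · exact (hzero' i h).symm
  have : y = 0 := by
    funext i
    by_cases h : kind i = .proximable ∨ kind i = .indicator
    · exact hzero i h
    · exact hzero' i h
  rw [this] at hy1
  simp at hy1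

end Recession

/-! ### Invariants of the run: models and shape of the dual blocks -/

section Invariants

variable {V : Type*} {m : ℕ}

/-- The node functions `g` agree with `f` off `V₄`, and are real convex minorants of `f` on `V₄`. -/
structure IsModel (kind : V → NodeKind) (f g : V → Block m → EReal) : Prop where
  eq_of_ne : ∀ i, kind i ≠ .subdifferentiable → g i = f i
  convex : ∀ i, kind i = .subdifferentiable →
    ∃ gr : Block m → ℝ, ConvexOn ℝ Set.univ gr ∧ ∀ x, g i x = (gr x : EReal)
  le_sub : ∀ i, kind i = .subdifferentiable → ∀ x, g i x ≤ f i x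

lemma isClosedConvexFn_of_convexOn {g : Block m → EReal} {gr : Block m → ℝ}
    (hc : ConvexOn ℝ Set.univ gr) (hg : ∀ x, g x = (gr x : EReal)) : IsClosedConvexFn g := by
  obtain rfl : g = fun x => (gr x : EReal) := funext hg
  refine ⟨fun x => EReal.coe_ne_bot _, ?_, by simpa using hc.convex_epigraph⟩
  exact (continuous_coe_real_ereal.comp
    (continuousOn_univ.1 (hc.continuousOn isOpen_univ))).lowerSemicontinuous

variable {kind : V → NodeKind} {f g : V → Block m → EReal}

lemma IsModel.le (hg : IsModel kind f g) (i : V) (x : Block m) : g i x ≤ f i x := by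
  by_cases h : kind i = .subdifferentiable
  · exact hg.le_sub i h x
  · rw [hg.eq_of_ne i h]

lemma IsModel.exists_ne_top (hg : IsModel kind f g) (hfeas : ∃ x : Block m, ∀ i, x ∈ effDom (f i))
    (i : V) : ∃ x, g i x ≠ ⊤ := by
  obtain ⟨x, hx⟩ := hfeas
  exact ⟨x, ne_top_of_le_ne_top (lt_top_iff_ne_top.1 (hx i)) (hg.le i x)⟩

lemma IsModel.isClosedConvexFn {σ : ℝ} (hg : IsModel kind f g) (hf : NodeAssumptions kind f σ)
    (i : V) : IsClosedConvexFn (g i) := by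
  by_cases h : kind i = .subdifferentiable
  · obtain ⟨gr, h1, h2⟩ := hg.convex i h
    exact isClosedConvexFn_of_convexOn h1 h2
  · rw [hg.eq_of_ne i h]; exact (hf i).1

lemma affine_convexOn (c : ℝ) (s : Block m) :
    ConvexOn ℝ Set.univ fun x : Block m => c + inner ℝ s x := by
  refine ⟨convex_univ, fun x _ y _ a b _ _ hab => le_of_eq ?_⟩
  beta_reduce
  rw [inner_add_right, inner_smul_right, inner_smul_right, smul_eq_mul, smul_eq_mul]
  linear_combination (-c) * hab

variable [Fintype V] {G : SimpleGraph V}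

lemma boldFn_inl_congr {g g' : V → Block m → EReal} {i : V} (h : g i = g' i) :
    boldFn G m g (Sum.inl i) = boldFn G m g' (Sum.inl i) := by
  simp only [boldFn, h]

/-- Node blocks are supported on their node, edge blocks are orthogonal to their subspace. -/
structure IsDualShape (G : SimpleGraph V) (z : DualIdx G m → NodeProd V m) : Prop where
  sparse : ∀ i j, j ≠ i → z (Sum.inl i) j = 0
  perp : ∀ α, z (Sum.inr α) ∈ (edgeSubspace G m α)ᗮ

lemma exists_boldFn_ne_top (hg : ∀ i, ∃ x, g i x ≠ ⊤) (α : DualIdx G m) :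
    ∃ x, boldFn G m g α x ≠ ⊤ := by
  rcases α with i | α
  · obtain ⟨x, hx⟩ := hg i
    exact ⟨WithLp.toLp 2 fun _ => x, hx⟩
  · exact exists_indicatorFn_ne_top _

lemma exists_conjugate_boldFn_ne_top (hd : ∀ i, ∃ x, g i x ≠ ⊤)
    (hc : ∀ i, IsClosedConvexFn (g i)) (α : DualIdx G m) :
    ∃ z, conjugate (boldFn G m g α) z ≠ ⊤ := by
  classical
  rcases α with i | α
  · obtain ⟨y, hy⟩ := (hc i).exists_conjugate_ne_top (hd i)
    refine ⟨WithLp.toLp 2 (Function.update 0 i y), ?_⟩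
    rw [conjugate_boldFn_inl_of_sparse G (by intro j hj; simp [hj])]
    simpa using hy
  · exact ⟨0, by
      change conjugate (indicatorFn _) 0 ≠ ⊤
      rw [conjugate_indicatorFn_of_mem (Submodule.zero_mem _)]
      exact EReal.zero_ne_top⟩

variable [Fintype G.edgeSet] {xbar : NodeProd V m}

/-- No other node block reaches node `i`, so the linearization point of the algorithm is the
corresponding block of the full residual. -/
lemma residual_apply {z : DualIdx G m → NodeProd V m} (hz : ∀ i j, j ≠ i → z (Sum.inl i) j = 0)
    (i : V) : (xbar - ∑ α, z α) i = (xbar - vH G m z - z (Sum.inl i)) i := by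
  have h : (∑ k : V, z (Sum.inl k)) i = z (Sum.inl i) i := by
    rw [WithLp.ofLp_sum, Finset.sum_apply]
    exact Finset.sum_eq_single i (fun k _ hk => hz k i hk.symm) (by simp)
  rw [Fintype.sum_sum_type]
  simp only [vH, PiLp.sub_apply, PiLp.add_apply, h]
  abel

variable {wbar : ℕ} {Creg : ℝ} {En : ℕ → Set (EdgeIdx G m)} {S : ℕ → ℕ → Finset (DualIdx G m)}
  {fm : ℕ → ℕ → V → Block m → EReal} {z : ℕ → ℕ → DualIdx G m → NodeProd V m} {σ : ℝ}

/-- The conclusions of one linearized step at a node. -/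
lemma IsDykstraRun.node_step (hrun : IsDykstraRun G m kind f xbar wbar Creg En S fm z)
    (hf : NodeAssumptions kind f σ) (hσ : 0 < σ) {n w : ℕ} (hn : 1 ≤ n) (hw : w + 1 ≤ wbar)
    (hM : IsModel kind f (fm n w)) (hZ : IsDualShape G (z n w))
    (hS : (S n (w + 1) : Set (DualIdx G m)) ⊆ subdiffIdx G m kind) {i : V}
    (hi : Sum.inl i ∈ S n (w + 1)) :
    kind i = .subdifferentiable ∧ (∀ j, j ≠ i → z n (w + 1) (Sum.inl i) j = 0) ∧
    ∃ c : ℝ, (∀ x, fm n (w + 1) i x = ((c + inner ℝ (z n (w + 1) (Sum.inl i) i) x : ℝ) : EReal)) ∧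
      (∀ x, fm n (w + 1) i x ≤ f i x) ∧
      (∀ (y : Block m) (r : ℝ), conjugate (fm n w i) y ≤ (r : EReal) →
        -c + inner ℝ ((xbar - vH G m (z n w)) i - z n (w + 1) (Sum.inl i) i)
          (y - z n (w + 1) (Sum.inl i) i) ≤ r) ∧
      ∀ (y : Block m) (r : ℝ), conjugate (f i) y ≤ (r : EReal) →
        -c + inner ℝ ((xbar - vH G m (z n w)) i - z n (w + 1) (Sum.inl i) i)
          (y - z n (w + 1) (Sum.inl i) i) ≤ r + 1 / σ *
            ‖((xbar - vH G m (z n w)) i - z n (w + 1) (Sum.inl i) i)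
              - (xbar - ∑ α, z n w α) i‖ ^ 2 := by
  have hk : kind i = .subdifferentiable := by
    obtain ⟨j, hj, hji⟩ := hS (Finset.mem_coe.2 hi)
    rw [← Sum.inl.inj hji]; exact hj
  obtain ⟨h1, h2⟩ := (hrun.subgradient_step n hn w hw hS).1 i hi
  obtain ⟨fr, hfr, hd, hL⟩ := (hf i).2.2.2 hk
  obtain ⟨gr, hgc, hgr⟩ := hM.convex i hk
  obtain ⟨c, hc1, hc2, hc3, hc4⟩ := h1.spec hfr hgr hgc (hM.le i)
  refine ⟨hk, h2, c, hc1, hc2, hc3, ?_⟩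
  rw [residual_apply hZ.sparse]
  exact hc4 σ hσ hd hL

lemma IsDykstraRun.fm_eq_of_not_mem (hrun : IsDykstraRun G m kind f xbar wbar Creg En S fm z)
    {n w : ℕ} (hn : 1 ≤ n) (hw : w + 1 ≤ wbar) {i : V} (hi : Sum.inl i ∉ S n (w + 1)) :
    fm n (w + 1) i = fm n w i := by
  by_cases hk : kind i = .subdifferentiable
  · by_cases hS : (S n (w + 1) : Set (DualIdx G m)) ⊆ subdiffIdx G m kind
    · exact (hrun.subgradient_step n hn w hw hS).2 i hk hi
    · exact (hrun.block_step n hn w hw hS).1 i hk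
  · rw [hrun.fm_eq n hn _ hw i hk, hrun.fm_eq n hn _ (by omega) i hk]

lemma IsDykstraRun.isModel_step (hrun : IsDykstraRun G m kind f xbar wbar Creg En S fm z)
    (hf : NodeAssumptions kind f σ) (hσ : 0 < σ) {n w : ℕ} (hn : 1 ≤ n) (hw : w + 1 ≤ wbar)
    (hM : IsModel kind f (fm n w)) (hZ : IsDualShape G (z n w)) :
    IsModel kind f (fm n (w + 1)) := by
  refine ⟨fun i hi => hrun.fm_eq n hn _ hw i hi, fun i hi => ?_, fun i hi => ?_⟩ <;>
  by_cases hS : (S n (w + 1) : Set (DualIdx G m)) ⊆ subdiffIdx G m kind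
  · by_cases hmem : Sum.inl i ∈ S n (w + 1)
    · obtain ⟨-, -, c, hc, -⟩ := hrun.node_step hf hσ hn hw hM hZ hS hmem
      exact ⟨_, affine_convexOn c _, hc⟩
    · rw [hrun.fm_eq_of_not_mem hn hw hmem]; exact hM.convex i hi
  · rw [(hrun.block_step n hn w hw hS).1 i hi]; exact hM.convex i hi
  · by_cases hmem : Sum.inl i ∈ S n (w + 1)
    · obtain ⟨-, -, c, -, hc, -⟩ := hrun.node_step hf hσ hn hw hM hZ hS hmem
      exact hc
    · rw [hrun.fm_eq_of_not_mem hn hw hmem]; exact hM.le i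
  · rw [(hrun.block_step n hn w hw hS).1 i hi]; exact hM.le i

/-- The conclusions of one block minimization. -/
lemma IsDykstraRun.block_subgradient (hrun : IsDykstraRun G m kind f xbar wbar Creg En S fm z)
    (hf : NodeAssumptions kind f σ) (hfeas : ∃ x : Block m, ∀ i, x ∈ effDom (f i))
    {n w : ℕ} (hn : 1 ≤ n) (hw : w + 1 ≤ wbar) (hM : IsModel kind f (fm n (w + 1)))
    (hS : ¬ (S n (w + 1) : Set (DualIdx G m)) ⊆ subdiffIdx G m kind) :
    ∀ α ∈ S n (w + 1), ∃ c : ℝ,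
      conjugate (boldFn G m (fm n (w + 1)) α) (z n (w + 1) α) = (c : EReal) ∧
      ∀ (y : NodeProd V m) (r : ℝ), conjugate (boldFn G m (fm n (w + 1)) α) y ≤ (r : EReal) →
        c + inner ℝ (xbar - ∑ β, z n (w + 1) β) (y - z n (w + 1) α) ≤ r := by
  have hd := hM.exists_ne_top hfeas
  refine conjugate_subgradient_of_block_min (exists_boldFn_ne_top hd)
    (fun α _ => exists_conjugate_boldFn_ne_top hd (hM.isClosedConvexFn hf) α) fun y hy => ?_
  refine (hrun.block_step n hn w hw hS).2 y fun α hα => ?_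
  rw [hy α hα, hrun.keep n hn w hw α hα]

/-- A block minimizer has finite conjugate terms, and finiteness alone forces sparsity of node
blocks and orthogonality of edge blocks. Linearized steps impose sparsity directly. -/
lemma IsDykstraRun.isDualShape_step (hrun : IsDykstraRun G m kind f xbar wbar Creg En S fm z)
    (hf : NodeAssumptions kind f σ) (hσ : 0 < σ) (hfeas : ∃ x : Block m, ∀ i, x ∈ effDom (f i))
    {n w : ℕ} (hn : 1 ≤ n) (hw : w + 1 ≤ wbar)
    (hM : IsModel kind f (fm n w)) (hZ : IsDualShape G (z n w)) :
    IsDualShape G (z n (w + 1)) := by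
  have hM' := hrun.isModel_step hf hσ hn hw hM hZ
  constructor
  · intro i
    by_cases hmem : Sum.inl i ∈ S n (w + 1)
    · by_cases hS : (S n (w + 1) : Set (DualIdx G m)) ⊆ subdiffIdx G m kind
      · exact (hrun.node_step hf hσ hn hw hM hZ hS hmem).2.1
      · obtain ⟨c, hc, -⟩ := hrun.block_subgradient hf hfeas hn hw hM' hS _ hmem
        exact sparse_of_conjugate_boldFn_ne_top G (hM'.exists_ne_top hfeas i)
          (by rw [hc]; exact EReal.coe_ne_top _)
    · rw [hrun.keep n hn w hw _ hmem]; exact hZ.sparse i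
  · intro α
    by_cases hmem : Sum.inr α ∈ S n (w + 1)
    · have hS : ¬ (S n (w + 1) : Set (DualIdx G m)) ⊆ subdiffIdx G m kind := by
        intro h
        obtain ⟨j, -, hj⟩ := h (Finset.mem_coe.2 hmem)
        cases hj
      obtain ⟨c, hc, -⟩ := hrun.block_subgradient hf hfeas hn hw hM' hS _ hmem
      exact mem_orthogonal_of_conjugate_ne_top (by
        change conjugate (boldFn G m (fm n (w + 1)) (Sum.inr α)) _ ≠ ⊤
        rw [hc]; exact EReal.coe_ne_top _)
    · rw [hrun.keep n hn w hw _ hmem]; exact hZ.perp α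

lemma IsDykstraRun.invariant (hrun : IsDykstraRun G m kind f xbar wbar Creg En S fm z)
    (hf : NodeAssumptions kind f σ) (hσ : 0 < σ) (hfeas : ∃ x : Block m, ∀ i, x ∈ effDom (f i))
    {n : ℕ} (hn : 1 ≤ n) : ∀ w ≤ wbar, IsModel kind f (fm n w) ∧ IsDualShape G (z n w) := by
  have hcycle : ∀ n ≥ 1, (IsModel kind f (fm n 0) ∧ IsDualShape G (z n 0)) →
      ∀ w ≤ wbar, IsModel kind f (fm n w) ∧ IsDualShape G (z n w) := by
    intro n hn h0 w
    induction w with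
    | zero => exact fun _ => h0
    | succ w ih =>
      intro hw
      obtain ⟨h1, h2⟩ := ih (by omega)
      exact ⟨hrun.isModel_step hf hσ hn hw h1 h2, hrun.isDualShape_step hf hσ hfeas hn hw h1 h2⟩
  refine hcycle n hn ?_
  induction n, hn using Nat.le_induction with
  | base =>
    exact ⟨⟨hrun.fm_eq 1 le_rfl 0 (Nat.zero_le _), fun i hi => (hrun.start_minorant i hi).1,
      fun i hi => (hrun.start_minorant i hi).2⟩, hrun.start_sparse, hrun.reset_perp 1 le_rfl⟩
  | succ n hn ih =>
    obtain ⟨h1, h2⟩ := hcycle n hn ih wbar le_rfl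
    refine ⟨⟨hrun.fm_eq _ (by omega) 0 (Nat.zero_le _), fun i hi => ?_, fun i hi => ?_⟩,
      fun i => ?_, hrun.reset_perp _ (by omega)⟩
    · rw [hrun.next_fm n hn i hi]; exact h1.convex i hi
    · rw [hrun.next_fm n hn i hi]; exact h1.le i
    · rw [hrun.next_z n hn i]; exact h2.sparse i

end Invariants

/-! ### Descent, finiteness and anchors along a cycle -/

section Steps

lemma inr_not_mem_of_subset_subdiffIdx {V : Type*} {G : SimpleGraph V} {m : ℕ}
    {kind : V → NodeKind} {T : Finset (DualIdx G m)}
    (hT : (T : Set (DualIdx G m)) ⊆ subdiffIdx G m kind) (α : EdgeIdx G m) : Sum.inr α ∉ T := by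
  intro h
  obtain ⟨j, -, hj⟩ := hT (Finset.mem_coe.2 h)
  cases hj

variable {V : Type*} [Fintype V] {G : SimpleGraph V} [Fintype G.edgeSet] {m : ℕ}
  {kind : V → NodeKind} {f : V → Block m → EReal} {xbar : NodeProd V m}
  {wbar : ℕ} {Creg : ℝ} {En : ℕ → Set (EdgeIdx G m)} {S : ℕ → ℕ → Finset (DualIdx G m)}
  {fm : ℕ → ℕ → V → Block m → EReal} {z : ℕ → ℕ → DualIdx G m → NodeProd V m} {σ : ℝ}

lemma IsDykstraRun.boldFn_eq_of_not_mem
    (hrun : IsDykstraRun G m kind f xbar wbar Creg En S fm z)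
    {n w : ℕ} (hn : 1 ≤ n) (hw : w + 1 ≤ wbar) {α : DualIdx G m} (hα : α ∉ S n (w + 1)) :
    boldFn G m (fm n (w + 1)) α = boldFn G m (fm n w) α := by
  rcases α with i | α
  · exact boldFn_inl_congr (hrun.fm_eq_of_not_mem hn hw hα)
  · rfl

/-- In a linearized step the residual at an updated node is the proximal point. -/
lemma IsDykstraRun.residual_node_step (hrun : IsDykstraRun G m kind f xbar wbar Creg En S fm z)
    {n w : ℕ} (hn : 1 ≤ n) (hw : w + 1 ≤ wbar) (hZ : IsDualShape G (z n (w + 1)))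
    (hS : (S n (w + 1) : Set (DualIdx G m)) ⊆ subdiffIdx G m kind) (i : V) :
    (xbar - vH G m (z n w)) i - z n (w + 1) (Sum.inl i) i = (xbar - ∑ α, z n (w + 1) α) i := by
  have hv : vH G m (z n (w + 1)) = vH G m (z n w) :=
    Finset.sum_congr rfl fun α _ =>
      hrun.keep n hn w hw _ (inr_not_mem_of_subset_subdiffIdx hS α)
  rw [residual_apply hZ.sparse, hv]
  rfl

/-- The common form of exact and linearized updates. The old term may be infinite: this is how an
infinite start becomes finite after one update. -/
lemma IsDykstraRun.conjugate_step (hrun : IsDykstraRun G m kind f xbar wbar Creg En S fm z)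
    (hf : NodeAssumptions kind f σ) (hσ : 0 < σ) (hfeas : ∃ x : Block m, ∀ i, x ∈ effDom (f i))
    {n w : ℕ} (hn : 1 ≤ n) (hw : w + 1 ≤ wbar) {α : DualIdx G m} (hα : α ∈ S n (w + 1)) :
    ∃ c : ℝ, conjugate (boldFn G m (fm n (w + 1)) α) (z n (w + 1) α) = (c : EReal) ∧
      ∀ r : ℝ, conjugate (boldFn G m (fm n w) α) (z n w α) ≤ (r : EReal) →
        c + inner ℝ (xbar - ∑ β, z n (w + 1) β) (z n w α - z n (w + 1) α) ≤ r := by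
  obtain ⟨hM, hZ⟩ := hrun.invariant hf hσ hfeas hn w (by omega)
  obtain ⟨hM', hZ'⟩ := hrun.invariant hf hσ hfeas hn (w + 1) hw
  by_cases hS : (S n (w + 1) : Set (DualIdx G m)) ⊆ subdiffIdx G m kind
  · rcases α with i | α
    · obtain ⟨-, hsp, c, hc1, -, hc3, -⟩ := hrun.node_step hf hσ hn hw hM hZ hS hα
      refine ⟨-c, ?_, fun r hr => ?_⟩
      · rw [conjugate_boldFn_inl_of_sparse G hsp, conjugate_affine_self hc1]
      · rw [conjugate_boldFn_inl_of_sparse G (hZ.sparse i)] at hr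
        have h1 := hc3 _ _ hr
        rw [hrun.residual_node_step hn hw hZ' hS] at h1
        rw [real_inner_comm, inner_eq_of_sparse (i := i), real_inner_comm]
        · exact h1
        · intro j hj
          rw [PiLp.sub_apply, hZ.sparse i j hj, hsp j hj, sub_zero]
    · exact absurd hα (inr_not_mem_of_subset_subdiffIdx hS α)
  · obtain ⟨c, hc1, hc2⟩ := hrun.block_subgradient hf hfeas hn hw hM' hS α hα
    refine ⟨c, hc1, fun r hr => hc2 _ _ ?_⟩
    rcases α with i | α
    · have : fm n (w + 1) i = fm n w i := by
        by_cases hk : kind i = .subdifferentiable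
        · exact (hrun.block_step n hn w hw hS).1 i hk
        · rw [hM'.eq_of_ne i hk, hM.eq_of_ne i hk]
      rwa [boldFn_inl_congr this]
    · exact hr

/-- Every term of the dual function decreases by at least the linear part of the change. -/
lemma IsDykstraRun.term_descent (hrun : IsDykstraRun G m kind f xbar wbar Creg En S fm z)
    (hf : NodeAssumptions kind f σ) (hσ : 0 < σ) (hfeas : ∃ x : Block m, ∀ i, x ∈ effDom (f i))
    {n w : ℕ} (hn : 1 ≤ n) (hw : w + 1 ≤ wbar) (α : DualIdx G m) {a : ℝ}
    (ha : conjugate (boldFn G m (fm n w) α) (z n w α) = (a : EReal)) :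
    ∃ c : ℝ, conjugate (boldFn G m (fm n (w + 1)) α) (z n (w + 1) α) = (c : EReal) ∧
      c + inner ℝ (xbar - ∑ β, z n (w + 1) β) (z n w α - z n (w + 1) α) ≤ a := by
  by_cases hα : α ∈ S n (w + 1)
  · obtain ⟨c, h1, h2⟩ := hrun.conjugate_step hf hσ hfeas hn hw hα
    exact ⟨c, h1, h2 a ha.le⟩
  · refine ⟨a, ?_, ?_⟩
    · rw [hrun.boldFn_eq_of_not_mem hn hw hα, hrun.keep n hn w hw α hα, ha]
    · rw [hrun.keep n hn w hw α hα, sub_self, inner_zero_right, add_zero]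

/-- The reset redistributes the edge blocks within the orthogonal complements, where their conjugate
terms are zero. -/
lemma IsDykstraRun.conjugate_next (hrun : IsDykstraRun G m kind f xbar wbar Creg En S fm z)
    (hf : NodeAssumptions kind f σ) (hσ : 0 < σ) (hfeas : ∃ x : Block m, ∀ i, x ∈ effDom (f i))
    {n : ℕ} (hn : 1 ≤ n) (α : DualIdx G m) :
    conjugate (boldFn G m (fm (n + 1) 0) α) (z (n + 1) 0 α) =
      conjugate (boldFn G m (fm n wbar) α) (z n wbar α) := by
  obtain ⟨hM, hZ⟩ := hrun.invariant hf hσ hfeas hn wbar le_rfl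
  obtain ⟨hM', hZ'⟩ := hrun.invariant hf hσ hfeas (n := n + 1) (by omega) 0 (Nat.zero_le _)
  rcases α with i | α
  · have : fm (n + 1) 0 i = fm n wbar i := by
      by_cases hk : kind i = .subdifferentiable
      · exact hrun.next_fm n hn i hk
      · rw [hM'.eq_of_ne i hk, hM.eq_of_ne i hk]
    rw [boldFn_inl_congr this, hrun.next_z n hn i]
  · exact (conjugate_indicatorFn_of_mem (hZ'.perp α)).trans
      (conjugate_indicatorFn_of_mem (hZ.perp α)).symm

lemma IsDykstraRun.sum_next (hrun : IsDykstraRun G m kind f xbar wbar Creg En S fm z)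
    {n : ℕ} (hn : 1 ≤ n) : ∑ α, z (n + 1) 0 α = ∑ α, z n wbar α := by
  have h := hrun.next_vH n hn
  simp only [vH] at h
  rw [Fintype.sum_sum_type, Fintype.sum_sum_type, h]
  simp only [hrun.next_z n hn]

/-- Every node is updated during the cycle; its term is finite from then on, by descent. -/
lemma IsDykstraRun.term_finite_end (hrun : IsDykstraRun G m kind f xbar wbar Creg En S fm z)
    (hf : NodeAssumptions kind f σ) (hσ : 0 < σ) (hfeas : ∃ x : Block m, ∀ i, x ∈ effDom (f i))
    (hVcover : ∀ n ≥ 1, ∀ i, ∃ w, 1 ≤ w ∧ w ≤ wbar ∧ Sum.inl i ∈ S n w)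
    {n : ℕ} (hn : 1 ≤ n) (α : DualIdx G m) :
    ∃ c : ℝ, conjugate (boldFn G m (fm n wbar) α) (z n wbar α) = (c : EReal) := by
  rcases α with i | α
  · obtain ⟨w₀, h1, h2, h3⟩ := hVcover n hn i
    have key : ∀ w, w₀ ≤ w → w ≤ wbar →
        ∃ c : ℝ, conjugate (boldFn G m (fm n w) (Sum.inl i)) (z n w (Sum.inl i)) = (c : EReal) := by
      intro w hw₀
      induction w, hw₀ using Nat.le_induction with
      | base =>
        intro _
        obtain ⟨w', rfl⟩ : ∃ w', w₀ = w' + 1 := ⟨w₀ - 1, by omega⟩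
        obtain ⟨c, hc, -⟩ := hrun.conjugate_step hf hσ hfeas hn h2 h3
        exact ⟨c, hc⟩
      | succ w _ ih =>
        intro hw
        obtain ⟨a, ha⟩ := ih (by omega)
        obtain ⟨c, hc, -⟩ := hrun.term_descent hf hσ hfeas hn hw _ ha
        exact ⟨c, hc⟩
    exact key wbar h2 le_rfl
  · refine ⟨0, ?_⟩
    exact conjugate_indicatorFn_of_mem ((hrun.invariant hf hσ hfeas hn wbar le_rfl).2.perp α)

lemma IsDykstraRun.term_finite (hrun : IsDykstraRun G m kind f xbar wbar Creg En S fm z)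
    (hf : NodeAssumptions kind f σ) (hσ : 0 < σ) (hfeas : ∃ x : Block m, ∀ i, x ∈ effDom (f i))
    (hVcover : ∀ n ≥ 1, ∀ i, ∃ w, 1 ≤ w ∧ w ≤ wbar ∧ Sum.inl i ∈ S n w)
    {n : ℕ} (hn : 2 ≤ n) {w : ℕ} (hw : w ≤ wbar) (α : DualIdx G m) :
    ∃ c : ℝ, conjugate (boldFn G m (fm n w) α) (z n w α) = (c : EReal) := by
  induction w with
  | zero =>
    obtain ⟨k, rfl⟩ : ∃ k, n = k + 1 := ⟨n - 1, by omega⟩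
    rw [hrun.conjugate_next hf hσ hfeas (by omega)]
    exact hrun.term_finite_end hf hσ hfeas hVcover (by omega) α
  | succ w ih =>
    obtain ⟨a, ha⟩ := ih (by omega)
    obtain ⟨c, hc, -⟩ := hrun.term_descent hf hσ hfeas (by omega) hw α ha
    exact ⟨c, hc⟩

/-- The last update of a node in a cycle anchors its dual block: up to a quadratic error, some
residual of the cycle is a subgradient. -/
lemma IsDykstraRun.node_anchor (hrun : IsDykstraRun G m kind f xbar wbar Creg En S fm z)
    (hf : NodeAssumptions kind f σ) (hσ : 0 < σ) (hfeas : ∃ x : Block m, ∀ i, x ∈ effDom (f i))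
    (hS1 : (∃ i, kind i = .subdifferentiable) →
      ∀ n > 1, (S n 1 : Set (DualIdx G m)) = subdiffIdx G m kind)
    {n : ℕ} (hn : 2 ≤ n) (i : V) : ∀ w ≤ wbar,
    (kind i = .subdifferentiable → 1 ≤ w → ∃ c : ℝ, ∀ x, fm n w i x =
      ((c + inner ℝ (z n w (Sum.inl i) i) x : ℝ) : EReal)) ∧
    ((∃ w', 1 ≤ w' ∧ w' ≤ w ∧ Sum.inl i ∈ S n w') →
      ∃ k ≤ w, ∃ c : ℝ, conjugate (boldFn G m (fm n w) (Sum.inl i)) (z n w (Sum.inl i)) = (c : EReal) ∧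
        ∀ (y : NodeProd V m) (r : ℝ), conjugate (boldFn G m f (Sum.inl i)) y ≤ (r : EReal) →
          c + inner ℝ (xbar - ∑ β, z n k β) (y - z n w (Sum.inl i)) ≤ r + 1 / σ *
            ∑ l ∈ Finset.range w,
              ‖(xbar - ∑ β, z n (l + 1) β) - (xbar - ∑ β, z n l β)‖ ^ 2) := by
  -- The two claims go together: affinity of the `V₄` models after the first step is what handles
  -- `V₄` nodes inside later block minimizations.
  intro w
  induction w with
  | zero =>
    intro _
    refine ⟨fun _ h => absurd h (by norm_num), ?_⟩
    rintro ⟨w', h1, h2, -⟩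
    omega
  | succ w ih =>
    intro hw
    have hn1 : 1 ≤ n := by omega
    obtain ⟨ih1, ih2⟩ := ih (by omega)
    obtain ⟨hM, hZ⟩ := hrun.invariant hf hσ hfeas hn1 w (by omega)
    obtain ⟨hM', hZ'⟩ := hrun.invariant hf hσ hfeas hn1 (w + 1) hw
    set Δ : ℕ → ℝ := fun l => ‖(xbar - ∑ β, z n (l + 1) β) - (xbar - ∑ β, z n l β)‖ ^ 2 with hΔ
    have hΔ0 : ∀ l, 0 ≤ Δ l := fun l => by positivity
    have hσ' : 0 ≤ 1 / σ := by positivity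
    have hmono : 1 / σ * ∑ l ∈ Finset.range w, Δ l ≤ 1 / σ * ∑ l ∈ Finset.range (w + 1), Δ l := by
      refine mul_le_mul_of_nonneg_left ?_ hσ'
      rw [Finset.sum_range_succ]
      linarith [hΔ0 w]
    have hmem1 : kind i = .subdifferentiable → Sum.inl i ∈ S n 1 := by
      intro hk
      have : Sum.inl i ∈ (S n 1 : Set (DualIdx G m)) := by
        rw [hS1 ⟨i, hk⟩ n (by omega)]; exact ⟨i, hk, rfl⟩
      exact Finset.mem_coe.1 this
    have hkeep : fm n (w + 1) i = fm n w i → z n (w + 1) (Sum.inl i) = z n w (Sum.inl i) →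
        (∃ w', 1 ≤ w' ∧ w' ≤ w ∧ Sum.inl i ∈ S n w') →
        ∃ k ≤ w + 1, ∃ c : ℝ,
          conjugate (boldFn G m (fm n (w + 1)) (Sum.inl i)) (z n (w + 1) (Sum.inl i)) = (c : EReal) ∧
          ∀ (y : NodeProd V m) (r : ℝ), conjugate (boldFn G m f (Sum.inl i)) y ≤ (r : EReal) →
            c + inner ℝ (xbar - ∑ β, z n k β) (y - z n (w + 1) (Sum.inl i)) ≤ r + 1 / σ *
              ∑ l ∈ Finset.range (w + 1), Δ l := by
      intro h1 h2 h3
      obtain ⟨k, hk, c, hc, hcy⟩ := ih2 h3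
      refine ⟨k, by omega, c, ?_, fun y r hy => ?_⟩
      · rw [boldFn_inl_congr h1, h2, hc]
      · rw [h2]; exact (hcy y r hy).trans (by linarith)
    by_cases hmem : Sum.inl i ∈ S n (w + 1)
    · by_cases hS : (S n (w + 1) : Set (DualIdx G m)) ⊆ subdiffIdx G m kind
      · obtain ⟨hk, hsp, c, hc1, -, -, hc4⟩ := hrun.node_step hf hσ hn1 hw hM hZ hS hmem
        refine ⟨fun _ _ => ⟨c, hc1⟩, fun _ => ⟨w + 1, le_rfl, -c, ?_, fun y r hy => ?_⟩⟩
        · rw [conjugate_boldFn_inl_of_sparse G hsp, conjugate_affine_self hc1]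
        · have hfd : ∃ x, f i x ≠ ⊤ := by
            obtain ⟨x, hx⟩ := hfeas
            exact ⟨x, lt_top_iff_ne_top.1 (hx i)⟩
          have hy' := sparse_of_conjugate_boldFn_ne_top G hfd
            (ne_top_of_le_ne_top (EReal.coe_ne_top r) hy)
          rw [conjugate_boldFn_inl_of_sparse G hy'] at hy
          have h1 := hc4 _ _ hy
          rw [hrun.residual_node_step hn1 hw hZ' hS] at h1
          rw [real_inner_comm, inner_eq_of_sparse (i := i), real_inner_comm]
          · refine h1.trans (add_le_add le_rfl (mul_le_mul_of_nonneg_left ?_ hσ'))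
            rw [Finset.sum_range_succ]
            have h2 : ‖(xbar - ∑ α, z n (w + 1) α) i - (xbar - ∑ α, z n w α) i‖ ^ 2 ≤ Δ w := by
              refine pow_le_pow_left₀ (norm_nonneg _) ?_ 2
              exact PiLp.norm_apply_le ((xbar - ∑ α, z n (w + 1) α) - (xbar - ∑ α, z n w α)) i
            have h3 := Finset.sum_nonneg fun l (_ : l ∈ Finset.range w) => hΔ0 l
            linarith
          · intro j hj
            rw [PiLp.sub_apply, hy' j hj, hsp j hj, sub_zero]
      · obtain ⟨c, hc1, hc2⟩ := hrun.block_subgradient hf hfeas hn1 hw hM' hS _ hmem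
        -- For a node of `V₄` the model is already affine, so a finite conjugate value keeps the
        -- block at its slope and the earlier anchor survives. For other nodes the model is `f i`
        -- itself and the anchor is exact.
        by_cases hk : kind i = .subdifferentiable
        · have hfm := (hrun.block_step n hn1 w hw hS).1 i hk
          -- The first step of the cycle updates exactly `V₄`, so it is not a block minimization.
          have hw1 : 1 ≤ w := by
            by_contra hlt
            obtain rfl : w = 0 := by omega
            exact hS (hS1 ⟨i, hk⟩ n (by omega)).le
          obtain ⟨c', hc'⟩ := ih1 hk hw1
          have hz : z n (w + 1) (Sum.inl i) i = z n w (Sum.inl i) i := by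
            rw [conjugate_boldFn_inl_of_sparse G (hZ'.sparse i), hfm] at hc1
            exact ((conjugate_affine_le_iff hc').1 hc1.le).1
          have hz' : z n (w + 1) (Sum.inl i) = z n w (Sum.inl i) := by
            ext1 j
            by_cases hj : j = i
            · subst hj; exact hz
            · rw [hZ'.sparse i j hj, hZ.sparse i j hj]
          refine ⟨fun _ _ => ⟨c', fun x => ?_⟩, fun _ => hkeep hfm hz' ⟨1, le_rfl, hw1, hmem1 hk⟩⟩
          rw [hfm, hz', hc']
        · refine ⟨fun h => absurd h hk, fun _ => ⟨w + 1, le_rfl, c, hc1, fun y r hy => ?_⟩⟩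
          rw [← boldFn_inl_congr (hM'.eq_of_ne i hk)] at hy
          have h3 : 0 ≤ 1 / σ * ∑ l ∈ Finset.range (w + 1), Δ l :=
            mul_nonneg hσ' (Finset.sum_nonneg fun l _ => hΔ0 l)
          linarith [hc2 y r hy]
    · have hfm := hrun.fm_eq_of_not_mem hn1 hw hmem
      have hz := hrun.keep n hn1 w hw _ hmem
      refine ⟨fun hk _ => ?_, ?_⟩
      · have hw1 : 1 ≤ w := by
          by_contra hlt
          obtain rfl : w = 0 := by omega
          exact hmem (hmem1 hk)
        rw [hfm, hz]
        exact ih1 hk hw1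
      · rintro ⟨w', h1, h2, h3⟩
        refine hkeep hfm hz ⟨w', h1, ?_, h3⟩
        by_contra hlt
        obtain rfl : w' = w + 1 := by omega
        exact hmem h3

/-- After an edge has been updated the residual lies in its subspace. -/
lemma IsDykstraRun.edge_anchor (hrun : IsDykstraRun G m kind f xbar wbar Creg En S fm z)
    (hf : NodeAssumptions kind f σ) (hσ : 0 < σ) (hfeas : ∃ x : Block m, ∀ i, x ∈ effDom (f i))
    {n w : ℕ} (hn : 1 ≤ n) (hw : w + 1 ≤ wbar) {α : EdgeIdx G m}
    (hα : Sum.inr α ∈ S n (w + 1)) : xbar - ∑ β, z n (w + 1) β ∈ edgeSubspace G m α := by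
  have hS : ¬ (S n (w + 1) : Set (DualIdx G m)) ⊆ subdiffIdx G m kind :=
    fun h => inr_not_mem_of_subset_subdiffIdx h α hα
  obtain ⟨hM', hZ'⟩ := hrun.invariant hf hσ hfeas hn (w + 1) hw
  obtain ⟨c, hc1, hc2⟩ := hrun.block_subgradient hf hfeas hn hw hM' hS _ hα
  have hc0 : c = 0 := by
    have := hc1.symm.trans (conjugate_indicatorFn_of_mem (hZ'.perp α))
    exact_mod_cast this
  rw [← Submodule.orthogonal_orthogonal (edgeSubspace G m α), Submodule.mem_orthogonal]
  intro u hu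
  -- The conjugate vanishes on the whole complement, so the residual pairs nonpositively with both
  -- `v` and `-v`.
  have key : ∀ v ∈ (edgeSubspace G m α)ᗮ, inner ℝ (xbar - ∑ β, z n (w + 1) β) v ≤ 0 := by
    intro v hv
    have h1 := hc2 (z n (w + 1) (Sum.inr α) + v) 0
      (conjugate_indicatorFn_le_iff.2 ⟨Submodule.add_mem _ (hZ'.perp α) hv, le_rfl⟩)
    rwa [add_sub_cancel_left, hc0, zero_add] at h1
  have h1 := key u hu
  have h2 := key (-u) (Submodule.neg_mem _ hu)
  rw [inner_neg_right] at h2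
  rw [real_inner_comm]
  linarith

end Steps

/-! ### Real estimates: descent, gap and the squared gap -/

section Estimates

/-- Descent of `∑ a + ½‖b - ∑ z‖²` from the subgradient inequalities of its terms. -/
lemma value_descent {X ι : Type*} [NormedAddCommGroup X] [InnerProductSpace ℝ X] [Fintype ι]
    (b : X) {z z' : ι → X} {a a' : ι → ℝ}
    (h : ∀ α, a' α + inner ℝ (b - ∑ β, z' β) (z α - z' α) ≤ a α) :
    (∑ α, a' α + 1 / 2 * ‖b - ∑ β, z' β‖ ^ 2)
      + 1 / 2 * ‖(b - ∑ β, z' β) - (b - ∑ β, z β)‖ ^ 2 ≤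
    ∑ α, a α + 1 / 2 * ‖b - ∑ β, z β‖ ^ 2 := by
  have h1 := Finset.sum_le_sum fun α (_ : α ∈ Finset.univ) => h α
  rw [Finset.sum_add_distrib, ← inner_sum, Finset.sum_sub_distrib] at h1
  set x := b - ∑ β, z β with hx
  set x' := b - ∑ β, z' β with hx'
  have h2 : ∑ β, z β - ∑ β, z' β = x' - x := by rw [hx, hx']; abel
  rw [h2, inner_sub_right, real_inner_self_eq_norm_sq] at h1
  rw [norm_sub_sq_real x' x]
  linarith

/-- The gap at the end of a cycle is bounded by the total movement of the residual. -/
lemma gap_le_of_anchors {X V E : Type*} [NormedAddCommGroup X] [InnerProductSpace ℝ X]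
    [Fintype V] [Fintype E] {K : E → Submodule ℝ X} {C : ℝ} {E' : Set E} (hC0 : 0 ≤ C)
    (hC : ∀ (x v : X) (ε : ℝ), 0 ≤ ε → v ∈ (⨅ α, K α)ᗮ →
      (∀ α ∈ E', ∃ p ∈ K α, ‖x - p‖ ≤ ε) → |inner ℝ x v| ≤ C * ε * ‖v‖)
    {b : X} {z y : V ⊕ E → X} {a c : V ⊕ E → ℝ} {s q R R' : ℝ} (hs : 0 ≤ s)
    (hz : ∀ α, z (Sum.inr α) ∈ (K α)ᗮ) (hy : ∀ α, y (Sum.inr α) ∈ (K α)ᗮ)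
    (ha : ∀ α, a (Sum.inr α) = 0) (hc : ∀ α, c (Sum.inr α) = 0)
    (hnode : ∀ i, ∃ p, ‖p - (b - ∑ β, z β)‖ ≤ s ∧
      a (Sum.inl i) + inner ℝ p (y (Sum.inl i) - z (Sum.inl i)) ≤ c (Sum.inl i) + q)
    (hedge : ∀ α ∈ E', ∃ p ∈ K α, ‖(b - ∑ β, z β) - p‖ ≤ s)
    (hR : ∑ i, ‖y (Sum.inl i) - z (Sum.inl i)‖ ≤ R)
    (hR' : ‖(b - ∑ β, z β) - (b - ∑ β, y β)‖ ≤ R') :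
    (∑ α, a α + 1 / 2 * ‖b - ∑ β, z β‖ ^ 2) - (∑ α, c α + 1 / 2 * ‖b - ∑ β, y β‖ ^ 2) ≤
      s * R + C * s * (R' + R) + Fintype.card V * q := by
  set x := b - ∑ β, z β with hx
  set x' := b - ∑ β, y β with hx'
  -- Only the difference of the edge sums matters. It is the residual difference minus the node
  -- differences, hence bounded without control of individual edge blocks.
  set v := ∑ α, y (Sum.inr α) - ∑ α, z (Sum.inr α) with hv
  have hvD : v ∈ (⨅ α, K α)ᗮ := by
    have hle : ∀ α, (K α)ᗮ ≤ (⨅ α, K α)ᗮ := fun α => Submodule.orthogonal_le (iInf_le _ α)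
    exact Submodule.sub_mem _ (Submodule.sum_mem _ fun α _ => hle α (hy α))
      (Submodule.sum_mem _ fun α _ => hle α (hz α))
  have hsplit : x - x' = ∑ i, (y (Sum.inl i) - z (Sum.inl i)) + v := by
    rw [hx, hx', hv, Fintype.sum_sum_type, Fintype.sum_sum_type, Finset.sum_sub_distrib]
    abel
  have hnorm_sum : ‖∑ i, (y (Sum.inl i) - z (Sum.inl i))‖ ≤ R := (norm_sum_le _ _).trans hR
  have hvn : ‖v‖ ≤ R' + R := by
    have : v = (x - x') - ∑ i, (y (Sum.inl i) - z (Sum.inl i)) := by rw [hsplit]; abel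
    rw [this]
    exact (norm_sub_le _ _).trans (add_le_add hR' hnorm_sum)
  have h1 : inner ℝ x v ≤ C * s * (R' + R) :=
    (le_abs_self _).trans ((hC x v s hs hvD hedge).trans
      (mul_le_mul_of_nonneg_left hvn (mul_nonneg hC0 hs)))
  -- Replacing the anchor `p` by the final residual costs `s` times the node difference.
  have h2 : ∀ i, a (Sum.inl i) - c (Sum.inl i) ≤
      -inner ℝ x (y (Sum.inl i) - z (Sum.inl i)) + s * ‖y (Sum.inl i) - z (Sum.inl i)‖ + q := by
    intro i
    obtain ⟨p, hp1, hp2⟩ := hnode i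
    have h3 : inner ℝ p (y (Sum.inl i) - z (Sum.inl i)) =
        inner ℝ x (y (Sum.inl i) - z (Sum.inl i))
          + inner ℝ (p - x) (y (Sum.inl i) - z (Sum.inl i)) := by
      rw [← inner_add_left, add_sub_cancel]
    have h4 : -inner ℝ (p - x) (y (Sum.inl i) - z (Sum.inl i))
        ≤ s * ‖y (Sum.inl i) - z (Sum.inl i)‖ :=
      (neg_le_abs _).trans ((abs_real_inner_le_norm _ _).trans
        (mul_le_mul_of_nonneg_right hp1 (norm_nonneg _)))
    linarith
  have h5 := Finset.sum_le_sum fun i (_ : i ∈ Finset.univ) => h2 i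
  rw [Finset.sum_sub_distrib, Finset.sum_add_distrib, Finset.sum_add_distrib,
    Finset.sum_neg_distrib, ← inner_sum, ← Finset.mul_sum, Finset.sum_const, Finset.card_univ,
    nsmul_eq_mul] at h5
  have h6 : s * ∑ i, ‖y (Sum.inl i) - z (Sum.inl i)‖ ≤ s * R := mul_le_mul_of_nonneg_left hR hs
  have h7 : 1 / 2 * ‖x‖ ^ 2 - 1 / 2 * ‖x'‖ ^ 2 ≤ inner ℝ x (x - x') := by
    have := norm_sub_sq_real x x'
    rw [inner_sub_right, real_inner_self_eq_norm_sq]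
    nlinarith [sq_nonneg ‖x - x'‖]
  rw [hsplit, inner_add_right] at h7
  rw [Fintype.sum_sum_type, Fintype.sum_sum_type c]
  simp only [ha, hc, Finset.sum_const_zero, add_zero]
  linarith

lemma norm_sub_le_sum_range {X : Type*} [NormedAddCommGroup X] (x : ℕ → X) {k N : ℕ} (hk : k ≤ N) :
    ‖x N - x k‖ ≤ ∑ l ∈ Finset.range N, ‖x (l + 1) - x l‖ := by
  induction N, hk using Nat.le_induction with
  | base =>
    rw [sub_self, norm_zero]
    exact Finset.sum_nonneg fun _ _ => norm_nonneg _
  | succ N _ ih =>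
    rw [Finset.sum_range_succ]
    have : x (N + 1) - x k = (x N - x k) + (x (N + 1) - x N) := by abel
    rw [this]
    exact (norm_add_le _ _).trans (add_le_add ih le_rfl)

/-- Here `d` is the decrease of the gap over a cycle. The cross term is removed by `(u + v) ^ 2 ≤ 2
* u ^ 2 + 2 * v ^ 2`, and `d ≤ H` makes `q ^ 2` linear in `d`. -/
lemma sq_gap_le {g s q d A B N H : ℝ} (hg : 0 ≤ g) (hgb : g ≤ s * A + B * q) (hsq : s ^ 2 ≤ N * q)
    (hq0 : 0 ≤ q) (hqd : q ≤ 2 * d) (hdH : d ≤ H) (hN : 0 ≤ N) :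
    g ^ 2 ≤ (4 * A ^ 2 * N + 8 * B ^ 2 * H) * d := by
  have hd : 0 ≤ d := by linarith
  have h1 : g ^ 2 ≤ (s * A + B * q) ^ 2 := pow_le_pow_left₀ hg hgb 2
  have h2 : (s * A + B * q) ^ 2 ≤ 2 * (s * A) ^ 2 + 2 * (B * q) ^ 2 := by
    nlinarith [sq_nonneg (s * A - B * q)]
  have h3 : (s * A) ^ 2 ≤ A ^ 2 * (N * (2 * d)) := by
    rw [mul_pow, mul_comm]
    exact mul_le_mul_of_nonneg_left (hsq.trans (mul_le_mul_of_nonneg_left hqd hN)) (sq_nonneg _)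
  have h4 : q ^ 2 ≤ 4 * (H * d) := by
    have : q ^ 2 ≤ (2 * d) ^ 2 := pow_le_pow_left₀ hq0 hqd 2
    nlinarith
  have h5 : (B * q) ^ 2 ≤ B ^ 2 * (4 * (H * d)) := by
    rw [mul_pow]; exact mul_le_mul_of_nonneg_left h4 (sq_nonneg _)
  nlinarith

end Estimates

/-! ### Dual values, optimality and the sum of node blocks -/

section DualValue

variable {V : Type*} [Fintype V] {G : SimpleGraph V} {m : ℕ}
  {kind : V → NodeKind} {f g : V → Block m → EReal} {xbar : NodeProd V m}

lemma primal_minimizer_mem_dom {σ : ℝ} (hf : NodeAssumptions kind f σ)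
    (hfeas : ∃ x : Block m, ∀ i, x ∈ effDom (f i)) {xstar : Block m}
    (hx : ∀ x, primalFn xbar f xstar ≤ primalFn xbar f x) (i : V) : f i xstar ≠ ⊤ := by
  obtain ⟨x₀, hx₀⟩ := hfeas
  have h1 : primalFn xbar f x₀ ≠ ⊤ := EReal.sum_ne_top_of_forall _ _ fun i _ =>
    EReal.add_ne_top (EReal.coe_ne_top _) (lt_top_iff_ne_top.1 (hx₀ i))
  have h2 := EReal.ne_top_of_sum_ne_top Finset.univ _ (fun i _ =>
    EReal.add_ne_bot_iff.2 ⟨EReal.coe_ne_bot _, (hf i).1.1 xstar⟩)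
    (ne_top_of_le_ne_top h1 (hx x₀)) i (Finset.mem_univ i)
  intro h
  rw [h, EReal.coe_add_top] at h2
  exact h2 rfl

lemma norm_eq_of_sparse {z : NodeProd V m} {i : V} (hz : ∀ j, j ≠ i → z j = 0) :
    ‖z‖ = ‖z i‖ := by
  have h := inner_eq_of_sparse hz z
  rw [real_inner_self_eq_norm_sq, real_inner_self_eq_norm_sq] at h
  exact (sq_eq_sq₀ (norm_nonneg _) (norm_nonneg _)).1 h

lemma boldFn_mono (h : ∀ i x, g i x ≤ f i x) (α : DualIdx G m) (x : NodeProd V m) :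
    boldFn G m g α x ≤ boldFn G m f α x := by
  rcases α with i | α
  · exact h i _
  · exact le_rfl

variable [Fintype G.edgeSet]

lemma dualFn_eq_coe {z : DualIdx G m → NodeProd V m} {a : DualIdx G m → ℝ}
    (ha : ∀ α, conjugate (boldFn G m g α) (z α) = (a α : EReal)) :
    dualFn G m xbar g z = ((∑ α, a α + 1 / 2 * ‖xbar - ∑ α, z α‖ ^ 2 : ℝ) : EReal) := by
  unfold dualFn
  simp only [ha]
  rw [EReal.sum_coe, ← EReal.coe_add]

lemma dualFn_antitone (h : ∀ i x, g i x ≤ f i x) (z : DualIdx G m → NodeProd V m) :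
    dualFn G m xbar f z ≤ dualFn G m xbar g z :=
  add_le_add (Finset.sum_le_sum fun α _ => conjugate_antitone (boldFn_mono h α) _) le_rfl

/-- Global minimality is the block condition with every index in the block. -/
lemma dual_optimality {σ : ℝ} (hf : NodeAssumptions kind f σ)
    (hfeas : ∃ x : Block m, ∀ i, x ∈ effDom (f i)) {zstar : DualIdx G m → NodeProd V m}
    (hzstar : ∀ y, dualFn G m xbar f zstar ≤ dualFn G m xbar f y) (α : DualIdx G m) :
    ∃ c : ℝ, conjugate (boldFn G m f α) (zstar α) = (c : EReal) ∧
      ∀ (y : NodeProd V m) (r : ℝ), conjugate (boldFn G m f α) y ≤ (r : EReal) →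
        c + inner ℝ (xbar - ∑ β, zstar β) (y - zstar α) ≤ r := by
  have hd : ∀ i, ∃ x, f i x ≠ ⊤ := by
    obtain ⟨x, hx⟩ := hfeas
    exact fun i => ⟨x, lt_top_iff_ne_top.1 (hx i)⟩
  refine conjugate_subgradient_of_block_min (S := Finset.univ) (exists_boldFn_ne_top hd)
    (fun α _ => exists_conjugate_boldFn_ne_top hd (fun i => (hf i).1) α) (fun y _ => ?_) α
    (Finset.mem_univ _)
  have := hzstar y
  unfold dualFn at this
  rwa [add_comm (Finset.sum _ _), add_comm (Finset.sum _ _)] at this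

/-- Consensus vectors lie in every edge subspace, so the components of an edge block sum to zero; a
bounded residual therefore bounds the sum of the node blocks. -/
lemma IsDualShape.sum_node_blocks {z : DualIdx G m → NodeProd V m} (hz : IsDualShape G z) :
    ∑ i, z (Sum.inl i) i = ∑ j, (∑ α, z α) j := by
  have hedge : ∀ α, ∑ j, z (Sum.inr α) j = 0 := by
    intro α
    rw [← inner_self_eq_zero (𝕜 := ℝ)]
    have h := (Submodule.mem_orthogonal' _ _).1 (hz.perp α)
      (WithLp.toLp 2 fun _ => ∑ j, z (Sum.inr α) j) (fun i j _ => rfl)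
    rw [PiLp.inner_apply] at h
    rw [← h, sum_inner]
  have hnode : ∀ i, ∑ j, z (Sum.inl i) j = z (Sum.inl i) i := fun i =>
    Finset.sum_eq_single i (fun j _ hj => hz.sparse i j hj) (by simp)
  have : ∀ j, (∑ α, z α) j = ∑ α, z α j := fun j => by
    rw [WithLp.ofLp_sum, Finset.sum_apply]
  simp only [this]
  rw [Finset.sum_comm, Fintype.sum_sum_type]
  simp only [hnode, hedge, Finset.sum_const_zero, add_zero]

end DualValue

/-! ### The node bound and the convergence rate -/

section Main

variable {V : Type*} [Fintype V] {G : SimpleGraph V} [Fintype G.edgeSet] {m : ℕ}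
  {kind : V → NodeKind} {f : V → Block m → EReal} {xbar : NodeProd V m}
  {wbar : ℕ} {Creg : ℝ} {En : ℕ → Set (EdgeIdx G m)} {S : ℕ → ℕ → Finset (DualIdx G m)}
  {fm : ℕ → ℕ → V → Block m → EReal} {z : ℕ → ℕ → DualIdx G m → NodeProd V m} {σ : ℝ}

/-- The node blocks at the ends of the cycles are bounded under the constraint qualification as soon
as the dual values and the residuals are. -/
lemma IsDykstraRun.exists_node_bound (hrun : IsDykstraRun G m kind f xbar wbar Creg En S fm z)
    (hf : NodeAssumptions kind f σ) (hσ : 0 < σ) (hfeas : ∃ x : Block m, ∀ i, x ∈ effDom (f i))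
    {xstar : Block m} (hx : ∀ x, primalFn xbar f xstar ≤ primalFn xbar f x)
    (hcq : ConstraintQualification kind f xstar)
    {a : ℕ → ℕ → DualIdx G m → ℝ}
    (ha : ∀ n ≥ 2, ∀ w ≤ wbar, ∀ α,
      conjugate (boldFn G m (fm n w) α) (z n w α) = (a n w α : EReal))
    {A R : ℝ} (hA : ∀ n ≥ 2, ∑ α, a n wbar α ≤ A)
    (hR : ∀ n ≥ 2, ‖xbar - ∑ α, z n wbar α‖ ≤ R) :
    ∃ B : ℝ, ∀ n ≥ 2, ∀ i, ‖z n wbar (Sum.inl i)‖ ≤ B := by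
  obtain ⟨B, hB⟩ := hcq.exists_norm_le (fun i => (hf i).1.1) (primal_minimizer_mem_dom hf hfeas hx)
    (fun i hi x => by
      cases hk : kind i with
      | proximable => exact absurd (Or.inl hk) hi
      | indicator => exact absurd (Or.inr hk) hi
      | fullDomainProximable =>
        have : x ∈ effDom (f i) := by rw [(hf i).2.2.1 hk]; trivial
        exact lt_top_iff_ne_top.1 this
      | subdifferentiable =>
        obtain ⟨fr, hfr, -⟩ := (hf i).2.2.2 hk
        rw [hfr]; exact EReal.coe_ne_top _) (Fintype.card V * (‖xbar‖ + R)) A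
  refine ⟨B, fun n hn i => ?_⟩
  obtain ⟨hM, hZ⟩ := hrun.invariant hf hσ hfeas (n := n) (by omega) wbar le_rfl
  rw [norm_eq_of_sparse (hZ.sparse i)]
  refine hB (fun i => z n wbar (Sum.inl i) i) (fun i => a n wbar (Sum.inl i)) ?_ (fun i => ?_) ?_ i
  · rw [hZ.sum_node_blocks]
    refine (norm_sum_le _ _).trans ?_
    have h1 : ∀ j ∈ Finset.univ, ‖(∑ α, z n wbar α) j‖ ≤ ‖xbar‖ + R := by
      intro j _
      refine (PiLp.norm_apply_le _ j).trans ?_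
      have : ∑ α, z n wbar α = xbar - (xbar - ∑ α, z n wbar α) := by abel
      rw [this]
      exact (norm_sub_le _ _).trans (add_le_add le_rfl (hR n hn))
    refine (Finset.sum_le_card_nsmul _ _ _ h1).trans_eq ?_
    rw [nsmul_eq_mul, Finset.card_univ]
  · rw [← ha n hn wbar le_rfl, ← conjugate_boldFn_inl_of_sparse G (hZ.sparse i)]
    exact conjugate_antitone (boldFn_mono hM.le _) _
  · have h0 : ∀ α, a n wbar (Sum.inr α) = 0 := by
      intro α
      have := (ha n hn wbar le_rfl (Sum.inr α)).symm.trans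
        (conjugate_indicatorFn_of_mem (hZ.perp α))
      exact_mod_cast this
    have := hA n hn
    rw [Fintype.sum_sum_type] at this
    simpa [h0] using this

end Main

theorem mainTheorem3 {V : Type*} [Fintype V] (G : SimpleGraph V) [Fintype G.edgeSet]
    (hG : G.Connected) (m : ℕ)
    (kind : V → NodeKind) (f : V → Block m → EReal) (xbar : NodeProd V m)
    (σ : ℝ) (hσ : 0 < σ) (hf : NodeAssumptions kind f σ)
    (hfeas : ∃ x : Block m, ∀ i, x ∈ effDom (f i))
    (wbar : ℕ) (Creg : ℝ) (En : ℕ → Set (EdgeIdx G m)) (S : ℕ → ℕ → Finset (DualIdx G m))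
    (fm : ℕ → ℕ → V → Block m → EReal) (z : ℕ → ℕ → DualIdx G m → NodeProd V m)
    (hrun : IsDykstraRun G m kind f xbar wbar Creg En S fm z)
    (hEn : ∀ n ≥ 1, ∀ α, α ∈ En n ↔ ∃ w, 1 ≤ w ∧ w ≤ wbar ∧ Sum.inr α ∈ S n w)
    (hVcover : ∀ n ≥ 1, ∀ i, ∃ w, 1 ≤ w ∧ w ≤ wbar ∧ Sum.inl i ∈ S n w)
    (hS1 : (∃ i, kind i = .subdifferentiable) →
      ∀ n > 1, (S n 1 : Set (DualIdx G m)) = subdiffIdx G m kind)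
    (zstar : DualIdx G m → NodeProd V m)
    (hzstar : ∀ y, dualFn G m xbar f zstar ≤ dualFn G m xbar f y)
    (hbdd : (∃ B : ℝ, ∀ n ≥ 1, ∀ w ≤ wbar, ∀ i, ‖z n w (Sum.inl i)‖ ≤ B) ∨
      ∃ xstar : Block m, (∀ x, primalFn xbar f xstar ≤ primalFn xbar f x) ∧
        ConstraintQualification kind f xstar) :
    (∀ n ≥ 1, 0 ≤ dualGap G m xbar f fm z zstar n) ∧
    (∀ n ≥ 2, dualGap G m xbar f fm z zstar n ≠ ⊤) ∧
    ∃ C : ℝ, ∀ n ≥ 1, dualGap G m xbar f fm z zstar n ≠ ⊤ →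
      dualGap G m xbar f fm z zstar n ≤ ((C / n : ℝ) : EReal) := by
  choose c hc hcsub using dual_optimality hf hfeas hzstar
  set xs : NodeProd V m := xbar - ∑ α, zstar α with hxs
  set x : ℕ → ℕ → NodeProd V m := fun n w => xbar - ∑ α, z n w α with hxdef
  set Fs : ℝ := ∑ α, c α + 1 / 2 * ‖xs‖ ^ 2 with hFs
  have hFstar : dualFn G m xbar f zstar = (Fs : EReal) := dualFn_eq_coe (xbar := xbar) hc
  have hex : ∀ n w α, ∃ r : ℝ, 2 ≤ n → w ≤ wbar →
      conjugate (boldFn G m (fm n w) α) (z n w α) = (r : EReal) := by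
    intro n w α
    by_cases h : 2 ≤ n ∧ w ≤ wbar
    · obtain ⟨r, hr⟩ := hrun.term_finite hf hσ hfeas hVcover h.1 h.2 α
      exact ⟨r, fun _ _ => hr⟩
    · exact ⟨0, fun h1 h2 => absurd ⟨h1, h2⟩ h⟩
  choose a ha' using hex
  have ha : ∀ n ≥ 2, ∀ w ≤ wbar, ∀ α,
      conjugate (boldFn G m (fm n w) α) (z n w α) = (a n w α : EReal) :=
    fun n hn w hw α => ha' n w α hn hw
  set F : ℕ → ℕ → ℝ := fun n w => ∑ α, a n w α + 1 / 2 * ‖x n w‖ ^ 2 with hF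
  have hval : ∀ n ≥ 2, dualFn G m xbar (fm n 0) (z n 0) = (F n 0 : EReal) :=
    fun n hn => dualFn_eq_coe (xbar := xbar) (ha n hn 0 (Nat.zero_le _))
  have hgap : ∀ n ≥ 2, dualGap G m xbar f fm z zstar n = ((F n 0 - Fs : ℝ) : EReal) := by
    intro n hn
    rw [dualGap, hval n hn, hFstar, EReal.coe_sub]
  have hstep : ∀ n ≥ 2, ∀ w, w + 1 ≤ wbar →
      F n (w + 1) + 1 / 2 * ‖x n (w + 1) - x n w‖ ^ 2 ≤ F n w := by
    intro n hn w hw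
    refine value_descent xbar fun α => ?_
    obtain ⟨r, hr1, hr2⟩ := hrun.term_descent hf hσ hfeas (by omega) hw α
      (ha n hn w (by omega) α)
    rw [ha n hn _ hw, EReal.coe_eq_coe_iff] at hr1
    rwa [hr1]
  have hnext : ∀ n ≥ 2, F (n + 1) 0 = F n wbar := by
    intro n hn
    have h1 : ∀ α, a (n + 1) 0 α = a n wbar α := by
      intro α
      have := hrun.conjugate_next hf hσ hfeas (n := n) (by omega) α
      rw [ha _ (by omega) _ (Nat.zero_le _), ha _ hn _ le_rfl] at this
      exact_mod_cast this
    simp only [hF, hxdef, h1, hrun.sum_next (n := n) (by omega)]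
  have hdesc : ∀ n ≥ 2, ∀ w ≤ wbar,
      F n w + 1 / 2 * ∑ l ∈ Finset.range w, ‖x n (l + 1) - x n l‖ ^ 2 ≤ F n 0 := by
    intro n hn w
    induction w with
    | zero => simp
    | succ w ih =>
      intro hw
      rw [Finset.sum_range_succ]
      linarith [ih (by omega), hstep n hn w hw]
  have hQ0 : ∀ n w, 0 ≤ ∑ l ∈ Finset.range w, ‖x n (l + 1) - x n l‖ ^ 2 :=
    fun n w => Finset.sum_nonneg fun _ _ => by positivity
  have hmono : ∀ n ≥ 2, F n 0 ≤ F 2 0 := by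
    intro n hn
    induction n, hn using Nat.le_induction with
    | base => exact le_rfl
    | succ n hn ih =>
      rw [hnext n hn]
      linarith [hdesc n hn wbar le_rfl, hQ0 n wbar]
  -- Descent towards `zstar`, whose residual is a subgradient of each true conjugate; the models lie
  -- below `f`, so their conjugates lie above.
  have hstrong : ∀ n ≥ 2, ∀ w ≤ wbar, Fs + 1 / 2 * ‖xs - x n w‖ ^ 2 ≤ F n w := by
    intro n hn w hw
    refine value_descent xbar fun α => hcsub α _ _ ?_
    rw [← ha n hn w hw]
    exact conjugate_antitone
      (boldFn_mono (hrun.invariant hf hσ hfeas (by omega) w hw).1.le α) _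
  have hnonneg : ∀ n ≥ 2, 0 ≤ F n 0 - Fs := by
    intro n hn
    have := hstrong n hn 0 (Nat.zero_le _)
    nlinarith [sq_nonneg ‖xs - x n 0‖]
  refine ⟨fun n hn => ?_, fun n hn => by rw [hgap n hn]; exact EReal.coe_ne_top _, ?_⟩
  -- The value at `n = 1` may be infinite, so nonnegativity is argued in the extended reals.
  · rw [dualGap, EReal.sub_nonneg (Or.inr (by rw [hFstar]; exact EReal.coe_ne_top _))
      (Or.inr (by rw [hFstar]; exact EReal.coe_ne_bot _))]
    exact (hzstar _).trans
      (dualFn_antitone (hrun.invariant hf hσ hfeas hn 0 (Nat.zero_le _)).1.le _)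
  set H : ℝ := F 2 0 - Fs with hH
  have hH0 : 0 ≤ H := hnonneg 2 le_rfl
  -- Avoids a square root: `t ^ 2 ≤ 2 * H` implies `t ≤ 1 + 2 * H`.
  set R' : ℝ := 1 + 2 * H with hR'
  have hxR : ∀ n ≥ 2, ‖x n wbar - xs‖ ≤ R' := by
    intro n hn
    have h1 := hstrong n hn wbar le_rfl
    have h2 := hmono (n + 1) (by omega)
    rw [hnext n hn] at h2
    rw [norm_sub_rev] at h1
    have h3 : ‖x n wbar - xs‖ ^ 2 ≤ 2 * H := by linarith
    nlinarith [sq_nonneg (‖x n wbar - xs‖ - 1), norm_nonneg (x n wbar - xs)]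
  obtain ⟨B, hB⟩ : ∃ B : ℝ, ∀ n ≥ 2, ∀ i, ‖z n wbar (Sum.inl i)‖ ≤ B := by
    rcases hbdd with ⟨B, hB⟩ | ⟨xstar, hx1, hx2⟩
    · exact ⟨B, fun n hn i => hB n (by omega) wbar le_rfl i⟩
    · refine hrun.exists_node_bound hf hσ hfeas hx1 hx2 ha (A := F 2 0) (R := R' + ‖xs‖)
        (fun n hn => ?_) (fun n hn => ?_)
      · have h2 := hmono (n + 1) (by omega)
        rw [hnext n hn] at h2
        have h3 : F n wbar = ∑ α, a n wbar α + 1 / 2 * ‖x n wbar‖ ^ 2 := rfl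
        nlinarith [sq_nonneg ‖x n wbar‖]
      · have h3 : x n wbar = (x n wbar - xs) + xs := by abel
        change ‖x n wbar‖ ≤ _
        rw [h3]
        exact (norm_add_le _ _).trans (add_le_add (hxR n hn) le_rfl)
  obtain ⟨C, hC0, hC⟩ := exists_uniform_inner_le_of_near_subspaces (edgeSubspace G m)
  set R : ℝ := ∑ i : V, (‖zstar (Sum.inl i)‖ + B) with hR
  have hcperp : ∀ α, zstar (Sum.inr α) ∈ (edgeSubspace G m α)ᗮ := fun α =>
    mem_orthogonal_of_conjugate_ne_top (ne_of_eq_of_ne (hc (Sum.inr α)) (EReal.coe_ne_top _))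
  have hc0 : ∀ α, c (Sum.inr α) = 0 := by
    intro α
    have := (hc (Sum.inr α)).symm.trans (conjugate_indicatorFn_of_mem (hcperp α))
    exact_mod_cast this
  have hbound : ∀ n ≥ 2, F (n + 1) 0 - Fs ≤
      (∑ l ∈ Finset.range wbar, ‖x n (l + 1) - x n l‖) * (R + C * (R' + R)) +
      (Fintype.card V * (1 / σ)) * ∑ l ∈ Finset.range wbar, ‖x n (l + 1) - x n l‖ ^ 2 := by
    intro n hn
    have hn1 : 1 ≤ n := by omega
    obtain ⟨hM, hZ⟩ := hrun.invariant hf hσ hfeas hn1 wbar le_rfl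
    have ha0 : ∀ α, a n wbar (Sum.inr α) = 0 := by
      intro α
      have := (ha n hn wbar le_rfl (Sum.inr α)).symm.trans
        (conjugate_indicatorFn_of_mem (hZ.perp α))
      exact_mod_cast this
    rw [hnext n hn]
    refine (gap_le_of_anchors (K := edgeSubspace G m) hC0 (hC (En n) (hrun.connects n hn1))
      (b := xbar) (z := z n wbar) (y := zstar)
      (s := ∑ l ∈ Finset.range wbar, ‖x n (l + 1) - x n l‖)
      (q := 1 / σ * ∑ l ∈ Finset.range wbar, ‖x n (l + 1) - x n l‖ ^ 2) (R := R) (R' := R')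
      (Finset.sum_nonneg fun _ _ => norm_nonneg _) hZ.perp hcperp ha0 hc0 ?_ ?_ ?_
      (hxR n hn)).trans_eq (by ring)
    · intro i
      obtain ⟨w', h1, h2, h3⟩ := hVcover n hn1 i
      obtain ⟨k, hk, r, hr1, hr2⟩ :=
        (hrun.node_anchor hf hσ hfeas hS1 hn i wbar le_rfl).2 ⟨w', h1, h2, h3⟩
      rw [ha n hn wbar le_rfl, EReal.coe_eq_coe_iff] at hr1
      refine ⟨x n k, ?_, ?_⟩
      · rw [norm_sub_rev]
        exact norm_sub_le_sum_range (x n) hk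
      · rw [hr1]
        exact hr2 _ _ (hc (Sum.inl i)).le
    · intro α hα
      obtain ⟨w', h1, h2, h3⟩ := (hEn n hn1 α).1 hα
      obtain ⟨w, rfl⟩ : ∃ w, w' = w + 1 := ⟨w' - 1, by omega⟩
      exact ⟨x n (w + 1), hrun.edge_anchor hf hσ hfeas hn1 h2 h3,
        norm_sub_le_sum_range (x n) h2⟩
    · exact Finset.sum_le_sum fun i _ =>
        (norm_sub_le _ _).trans (add_le_add le_rfl (hB n hn i))
  -- The constant of `sq_gap_le` with `A = R + C * (R' + R)`, `B = card V / σ` and `N = wbar`.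
  set κ : ℝ := 4 * (R + C * (R' + R)) ^ 2 * wbar + 8 * (Fintype.card V * (1 / σ)) ^ 2 * H with hκ
  obtain ⟨C₁, hC₁⟩ := exists_le_div_of_sq_le (h := fun n => F n 0 - Fs) (K := κ) (by positivity)
    hnonneg (fun n hn => by
      refine sq_gap_le (hnonneg (n + 1) (by omega)) (hbound n hn) (d := _) ?_ (hQ0 n wbar) ?_ ?_
        (Nat.cast_nonneg wbar)
      · have := sq_sum_le_card_mul_sum_sq (s := Finset.range wbar)
          (f := fun l => ‖x n (l + 1) - x n l‖)
        simpa using this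
      · have := hdesc n hn wbar le_rfl
        rw [hnext n hn]
        linarith
      · have := hnonneg (n + 1) (by omega)
        linarith [hmono n hn])
  -- The recursion starts at 2; the maximum absorbs the first gap when it is finite.
  refine ⟨max C₁ (dualGap G m xbar f fm z zstar 1).toReal, fun n hn htop => ?_⟩
  have hn0 : (0 : ℝ) < n := by exact_mod_cast hn
  rcases Nat.eq_or_lt_of_le hn with rfl | hn2
  · refine (EReal.le_coe_toReal htop).trans ?_
    rw [EReal.coe_le_coe_iff]
    simp
  · rw [hgap n hn2, EReal.coe_le_coe_iff]
    refine (hC₁ n hn2).trans ?_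
    gcongr
    exact le_max_left _ _
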